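/- \textbf{Setting.} Let $1\le d\le n$ be integers, let $G_{d,n}$ be the Grassmannian of $d$-planes of $\mathbb R^n$, each plane $S$ being identified with the orthogonal projection onto it and $S_{jk}$ being its matrix entries, with the operator-norm distance; $\Omega\times G_{d,n}$ carries the maximum of the Euclidean distance and this distance. A $d$-varifold in an open set $\Omega\subset\mathbb R^n$ is a non-negative Radon measure $V$ on $\Omega\times G_{d,n}$; its mass $\|V\|$ is the push-forward under $(x,S)\mapsto x$ (extended by $0$ outside $\Omega$). $V$ is rectifiable if $V=\theta\,\mathcal H^d_{|M}\otimes\delta_{T_xM}$ with $M\subset\Omega$ countably $d$-rectifiable, $\theta\ge 0$ a multiplicity with $\theta>0$ $\mathcal H^d$-a.e. on $M$, and $T_xM$ the approximate tangent space of $M$ with multiplicity $\theta$. $V$ has (locally) bounded variations if for all $i,j,k\in\{1,\dots,n\}$ the distribution $\delta_{ijk}V(\varphi)=\int S_{jk}\,(S\nabla\varphi(y))_i\,dV(y,S)$, $\varphi\in C^1_c(\Omega)$, is a (signed) Radon measure in $\Omega$. For open $U\subset\Omega$, $\Delta_U(V,W)\in[0,\infty]$ is the supremum of $\left|\int\varphi\,dV-\int\varphi\,dW\right|$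 over all $1$-Lipschitz $\varphi:\Omega\times G_{d,n}\to[-1,1]$ with support (relative to $\Omega\times G_{d,n}$) contained in $U\times G_{d,n}$ that are integrable with respect to both $V$ and $W$. For $A\subset\mathbb R^n$, $A^\tau=\{y: d(y,A)<\tau\}$. Let $\rho,\xi,\eta:\mathbb R_+\to\mathbb R_+$ be of class $C^1$ and vanish on $[1,\infty)$, with $\rho$ decreasing (in the wide sense), $\rho'(0)=0$, $\int_{\mathbb R^n}\rho(|x|)\,dx=1$, with $\xi>0$ on $(0,1)$, $\int_{\mathbb R^n}\xi(|x|)\,dx=1$, and with $\eta$ not identically zero. Put $f_\epsilon(x)=\epsilon^{-n}f(|x|/\epsilon)$ for $f\in\{\rho,\xi,\eta\}$, $C_f=d\,\omega_d\int_0^1 f(r)r^{d-1}\,dr$ for $f\in\{\rho,\xi\}$, where $\omega_d$ is the volume of the unit ball of $\mathbb R^d$, and \[ \beta^{V,\epsilon}_{ijk}(x)=-\frac{C_\xi}{C_\rho}\,\frac{\int S_{jk}\,(S\nabla\rho_\epsilon(y-x))_i\,dV(y,S)}{\int\xi_\epsilon(y-x)\,d\|V\|(y)},\qquad c^{V,\epsilon}_{jk}(x)=\frac{\int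 S_{jk}\,\eta_\epsilon(y-x)\,dV(y,S)}{\int\eta_\epsilon(y-x)\,d\|V\|(y)} \] wherever the denominators are non-zero (in the degenerate case of a zero denominator the quotient is read as $0$). Let $A^{V,\epsilon}(x)$ be the solution of $a_{ijk}+c^{V,\epsilon}_{jk}(x)\sum_q a_{qiq}=\beta^{V,\epsilon}_{ijk}(x)$, that is, $A^{V,\epsilon}_{ijk}=\beta^{V,\epsilon}_{ijk}-c^{V,\epsilon}_{jk}\big((I+c^{V,\epsilon})^{-1}H\big)_i$ with $H_i=\sum_q\beta^{V,\epsilon}_{qiq}$. Let $\|\rho\|_{W^{1,\infty}}=\|\rho\|_\infty+\mathrm{lip}(\rho)$ and $\|\rho\|_{W^{2,\infty}}=\|\rho\|_\infty+\|\rho'\|_\infty+\mathrm{lip}(\rho')\in[0,\infty]$. \textbf{Theorem.} There are constants $C,\kappa>0$, depending only on $n,d,\xi,\eta$, with the following property. Let $\rho$ be as above, let $\Omega\subset\mathbb R^n$ be open, let $V$ be a rectifiable $d$-varifold in $\Omega$ with (locally) bounded variations, let $(V_h)_{h\in\mathbb N}$ be a sequence of $d$-varifolds in $\Omega$, and let $(\eta_h)_h,(d_h)_h$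 be two positive, decreasing (in the wide sense) sequences converging to $0$ such that for every ball $B=B_r(a)\subset\Omega$ centred at a point $a\in\operatorname{supp}\|V\|$, with radius $r$ small enough (smaller than some $r_0(a)>0$ that does not depend on $h$), and for every $h$, \[ \Delta_B(V,V_h)\le d_h\,\min\big(\|V\|(B^{\eta_h}),\|V_h\|(B^{\eta_h})\big). \] Then for $\|V\|$-almost every $x$, for every sequence $z_h\to x$ in $\mathbb R^n$ and every sequence of positive numbers $\epsilon_h\to0$ with $\eta_h/\epsilon_h\to0$, the following holds for all sufficiently large $h$. (a) The denominators $\int\xi_{\epsilon_h}(y-x)\,d\|V\|(y)$ and $\int\eta_{\epsilon_h}(y-x)\,d\|V\|(y)$ are positive, and \[ \max_{j,k}\left|c^{V_h,\epsilon_h}_{jk}(z_h)-c^{V,\epsilon_h}_{jk}(x)\right|\le C\,\|\rho\|_{W^{1,\infty}}\,\frac{d_h+|x-z_h|}{\epsilon_h}. \] (b) If $d_h+|x-z_h|\le\kappa\,\epsilon_h$, then the denominators $\int\xi_{\epsilon_h}(y-z_h)\,d\|V_h\|(y)$ and $\int\eta_{\epsilon_h}(y-z_h)\,d\|V_h\|(y)$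 are positive, and \[ \max_{i,j,k}\left\{\left|\beta^{V_h,\epsilon_h}_{ijk}(z_h)-\beta^{V,\epsilon_h}_{ijk}(x)\right|,\ \left|A^{V_h,\epsilon_h}_{ijk}(z_h)-A^{V,\epsilon_h}_{ijk}(x)\right|\right\}\le C\,\|\rho\|_{W^{2,\infty}}\,\frac{d_h+|x-z_h|}{\epsilon_h^2}. \] In particular, if $(d_h+|x-z_h|)/\epsilon_h^2\to0$, then the right-hand side in (a), and, provided that $\|\rho\|_{W^{2,\infty}}<\infty$, also the one in (b), tends to $0$ as $h\to\infty$. -/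

import Mathlib

open MeasureTheory Set Filter Topology
open scoped ENNReal NNReal Matrix

noncomputable section

namespace WSFF

/-- Euclidean space `ℝⁿ`. -/
abbrev E (n : ℕ) := EuclideanSpace ℝ (Fin n)

/-- The Grassmannian of `d`-dimensional subspaces of `ℝⁿ`, a subspace being represented by the
orthogonal projection onto it; as a subtype it carries the operator-norm distance. -/
abbrev Grass (d n : ℕ) :=
  {P : E n →L[ℝ] E n // IsSelfAdjoint P ∧ P * P = P ∧
    Module.finrank ℝ (LinearMap.range (P : E n →ₗ[ℝ] E n)) = d}

/-- The `d`-plane itself, as a set of points. -/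
def Grass.plane {d n : ℕ} (S : Grass d n) : Set (E n) := Set.range S.1

/-- The matrix entry `S_{jk}` of the orthogonal projection. -/
def Grass.entry {d n : ℕ} (S : Grass d n) (j k : Fin n) : ℝ :=
  S.1 (EuclideanSpace.single k 1) j

/-- A measure on `ℝⁿ` that is finite on the compact subsets of `Ω`: its restriction to the open
set `Ω` is a Radon measure. -/
def FiniteOnCompacts {n : ℕ} (Ω : Set (E n)) (μ : Measure (E n)) : Prop :=
  ∀ K : Set (E n), IsCompact K → K ⊆ Ω → μ K < ∞

/-- A `d`-varifold in `Ω`: a non-negative Radon measure on `Ω × G_{d,n}`, stored as a Borel measure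
on `ℝⁿ × G_{d,n}` that does not charge the complement of `Ω × G_{d,n}`. -/
structure Varifold (d n : ℕ) (Ω : Set (E n)) where
  measure : Measure (E n × Grass d n)
  measure_compl : measure (Ωᶜ ×ˢ univ) = 0
  finite_on_compacts : ∀ K : Set (E n), IsCompact K → K ⊆ Ω → measure (K ×ˢ univ) < ∞

/-- The mass `‖V‖`: push-forward of `V` under `(x, S) ↦ x`. -/
def Varifold.mass {d n : ℕ} {Ω : Set (E n)} (V : Varifold d n Ω) : Measure (E n) :=
  V.measure.map Prod.fst

/-- `ω_d`, the volume of the unit ball of `ℝᵈ`. -/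
def omega (d : ℕ) : ℝ := (volume (Metric.ball (0 : E d) 1)).toReal

/-- The `d`-dimensional Hausdorff measure on `ℝⁿ` with the usual normalization `ω_d / 2ᵈ`. -/
def hausdorff (d n : ℕ) : Measure (E n) :=
  ENNReal.ofReal (omega d / 2 ^ d) • Measure.hausdorffMeasure (d : ℝ)

/-- `M` is covered, up to an `ℋᵈ`-null set, by countably many Lipschitz images of `ℝᵈ`. -/
def CountablyRectifiable (d : ℕ) {n : ℕ} (M : Set (E n)) : Prop :=
  ∃ (N : Set (E n)) (F : ℕ → E d → E n), hausdorff d n N = 0 ∧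
    (∀ i, ∃ K : ℝ≥0, LipschitzWith K (F i)) ∧ M ⊆ N ∪ ⋃ i, Set.range (F i)

/-- The measure `θ ℋᵈ⌞M`. -/
def weighted (d : ℕ) {n : ℕ} (M : Set (E n)) (θ : E n → ℝ≥0) : Measure (E n) :=
  ((hausdorff d n).restrict M).withDensity (fun x => (θ x : ℝ≥0∞))

/-- `T` is the approximate tangent space at `x` of the set `M` with multiplicity `θ`: the blow-ups
of `θ ℋᵈ⌞M` at `x` converge weakly-∗ to `θ(x) ℋᵈ⌞T`. -/
def IsApproxTangent {d n : ℕ} (M : Set (E n)) (θ : E n → ℝ≥0) (x : E n) (T : Grass d n) : Prop :=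
  ∀ f : E n → ℝ, Continuous f → HasCompactSupport f →
    Tendsto (fun r : ℝ => (r ^ d)⁻¹ * ∫ y, f (r⁻¹ • (y - x)) ∂(weighted d M θ))
      (𝓝[>] 0) (𝓝 ((θ x : ℝ) * ∫ y in T.plane, f y ∂(hausdorff d n)))

/-- `V = v(M, θ) = θ ℋᵈ⌞M ⊗ δ_{T_x M}` for some countably `d`-rectifiable set `M` and some
multiplicity `θ`, positive almost everywhere on `M` (with Borel representatives of `M`, `θ` and of
the approximate tangent map). -/
def Varifold.IsRectifiable {d n : ℕ} {Ω : Set (E n)} (V : Varifold d n Ω) : Prop :=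
  ∃ (M : Set (E n)) (θ : E n → ℝ≥0) (T : E n → Grass d n),
    M ⊆ Ω ∧ MeasurableSet M ∧ CountablyRectifiable d M ∧
    Measurable θ ∧ (∀ᵐ x ∂((hausdorff d n).restrict M), 0 < θ x) ∧
    Measurable T ∧ (∀ᵐ x ∂((hausdorff d n).restrict M), IsApproxTangent M θ x (T x)) ∧
    V.measure = (weighted d M θ).map (fun x => (x, T x))

/-- The `G`-linear variation `δ_{ijk} V (φ) = ∫ S_{jk} (∇^S φ(y))_i dV(y,S)`, where
`∇^S φ = S ∇φ`. -/
def Varifold.variation {d n : ℕ} {Ω : Set (E n)} (V : Varifold d n Ω) (i j k : Fin n)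
    (φ : E n → ℝ) : ℝ :=
  ∫ p, p.2.entry j k * (p.2.1 (gradient φ p.1)) i ∂V.measure

/-- `V` has (locally) bounded variations: every `δ_{ijk} V`, a distribution on `C¹_c(Ω)`, is a
(signed) Radon measure in `Ω`, that is, the difference of two non-negative Radon measures. -/
def Varifold.HasBoundedVariations {d n : ℕ} {Ω : Set (E n)} (V : Varifold d n Ω) : Prop :=
  ∀ i j k : Fin n, ∃ μp μm : Measure (E n), FiniteOnCompacts Ω μp ∧ FiniteOnCompacts Ω μm ∧
    ∀ φ : E n → ℝ, ContDiff ℝ 1 φ → HasCompactSupport φ → tsupport φ ⊆ Ω →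
      V.variation i j k φ = ∫ x, φ x ∂μp - ∫ x, φ x ∂μm

/-- The test functions of the localized bounded-Lipschitz distance: `1`-Lipschitz functions on
`Ω × G_{d,n}` bounded by `1`, whose support (closed relative to `Ω × G_{d,n}`) lies in
`U × G_{d,n}`. -/
def IsFlatTest {d n : ℕ} (Ω U : Set (E n)) (φ : E n × Grass d n → ℝ) : Prop :=
  LipschitzOnWith 1 φ (Ω ×ˢ univ) ∧ (∀ p ∈ Ω ×ˢ (univ : Set (Grass d n)), |φ p| ≤ 1) ∧
    closure (Function.support φ ∩ Ω ×ˢ univ) ∩ Ω ×ˢ univ ⊆ U ×ˢ univ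

/-- The localized bounded-Lipschitz distance `Δ_U(V, W)`, with values in `[0, ∞]`. (A varifold may
have infinite mass in `U`; the supremum is over the test functions that both varifolds can
integrate.) -/
def flatDist {d n : ℕ} {Ω : Set (E n)} (U : Set (E n)) (V W : Varifold d n Ω) : ℝ≥0∞ :=
  ⨆ (φ : E n × Grass d n → ℝ) (_ : IsFlatTest Ω U φ) (_ : Integrable φ V.measure)
    (_ : Integrable φ W.measure), ENNReal.ofReal |∫ p, φ p ∂V.measure - ∫ p, φ p ∂W.measure|

/-- A profile `ℝ₊ → ℝ₊` of class `C¹` that vanishes on `[1, ∞)`. Only its values on `[0, ∞)`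
matter. -/
structure IsProfile (f : ℝ → ℝ) : Prop where
  contDiffOn : ContDiffOn ℝ 1 f (Ici 0)
  nonneg : ∀ t, 0 ≤ t → 0 ≤ f t
  eq_zero : ∀ t, 1 ≤ t → f t = 0

/-- The profile `ρ`. -/
structure IsRho (n : ℕ) (ρ : ℝ → ℝ) : Prop extends IsProfile ρ where
  antitoneOn : AntitoneOn ρ (Ici 0)
  deriv_zero : derivWithin ρ (Ici 0) 0 = 0
  integral_eq_one : ∫ x : E n, ρ ‖x‖ = 1

/-- The profile `ξ`. -/
structure IsXi (n : ℕ) (ξ : ℝ → ℝ) : Prop extends IsProfile ξ where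
  pos : ∀ t, 0 < t → t < 1 → 0 < ξ t
  integral_eq_one : ∫ x : E n, ξ ‖x‖ = 1

/-- The profile `η`; it must not vanish identically, since `c^{V,ε}` is a quotient by
`‖V‖ ∗ η_ε`. -/
structure IsEta (η : ℝ → ℝ) : Prop extends IsProfile η where
  ne_zero : ∃ t, 0 ≤ t ∧ η t ≠ 0

/-- `f_ε(x) = ε⁻ⁿ f(|x|/ε)`. -/
def rescale (n : ℕ) (f : ℝ → ℝ) (ε : ℝ) (x : E n) : ℝ := (ε ^ n)⁻¹ * f (‖x‖ / ε)

/-- `C_f = d ω_d ∫₀¹ f(r) r^{d-1} dr`. -/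
def kernelConst (d : ℕ) (f : ℝ → ℝ) : ℝ :=
  d * omega d * ∫ r in (0 : ℝ)..1, f r * r ^ (d - 1)

/-- `sup_{t ≥ 0} |f(t)|`, in `[0, ∞]`. -/
def supNorm (f : ℝ → ℝ) : ℝ≥0∞ := ⨆ t ∈ Ici (0 : ℝ), ‖f t‖ₑ

/-- The Lipschitz constant of `f` on `[0, ∞)`, in `[0, ∞]`. -/
def lipConst (f : ℝ → ℝ) : ℝ≥0∞ :=
  ⨆ s ∈ Ici (0 : ℝ), ⨆ t ∈ Ici (0 : ℝ), edist (f s) (f t) / edist s t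

/-- `‖f‖_{W^{1,∞}} = ‖f‖_∞ + lip(f)`. -/
def normW1 (f : ℝ → ℝ) : ℝ≥0∞ := supNorm f + lipConst f

/-- `‖f‖_{W^{2,∞}} = ‖f‖_∞ + ‖f'‖_∞ + lip(f')`. -/
def normW2 (f : ℝ → ℝ) : ℝ≥0∞ := supNorm f + normW1 (derivWithin f (Ici 0))

section Approximate

variable {d n : ℕ} {Ω : Set (E n)}

/-- `‖V‖ ∗ f_ε (x)`. -/
def Varifold.massConv (V : Varifold d n Ω) (f : ℝ → ℝ) (ε : ℝ) (x : E n) : ℝ :=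
  ∫ y, rescale n f ε (y - x) ∂V.mass

/-- The regularized variation `δ_{ijk} V ∗ ρ_ε (x) = ∫ S_{jk} (∇^S ρ_ε (y - x))_i dV(y,S)`. -/
def Varifold.variationConv (V : Varifold d n Ω) (ρ : ℝ → ℝ) (ε : ℝ) (x : E n)
    (i j k : Fin n) : ℝ :=
  ∫ p, p.2.entry j k * (p.2.1 (gradient (rescale n ρ ε) (p.1 - x))) i ∂V.measure

/-- `β^{V,ε}_{ijk}(x)`; it is meaningful where `‖V‖ ∗ ξ_ε (x) ≠ 0`. -/
def Varifold.betaApprox (V : Varifold d n Ω) (ρ ξ : ℝ → ℝ) (ε : ℝ) (x : E n)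
    (i j k : Fin n) : ℝ :=
  -(kernelConst d ξ / kernelConst d ρ) * (V.variationConv ρ ε x i j k / V.massConv ξ ε x)

/-- `c^{V,ε}_{jk}(x)`; it is meaningful where `‖V‖ ∗ η_ε (x) ≠ 0`. -/
def Varifold.cApprox (V : Varifold d n Ω) (η : ℝ → ℝ) (ε : ℝ) (x : E n) :
    Matrix (Fin n) (Fin n) ℝ :=
  fun j k => (∫ p, p.2.entry j k * rescale n η ε (p.1 - x) ∂V.measure) / V.massConv η ε x

end Approximate

/-- The solution `a_{ijk} = b_{ijk} - c_{jk} ((I + c)⁻¹ h)_i`, `h_i = ∑_q b_{qiq}`, of the linear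
system `a_{ijk} + c_{jk} ∑_q a_{qiq} = b_{ijk}`. -/
def solveSystem {n : ℕ} (c : Matrix (Fin n) (Fin n) ℝ) (b : Fin n → Fin n → Fin n → ℝ)
    (i j k : Fin n) : ℝ :=
  b i j k - c j k * ((1 + c)⁻¹ *ᵥ fun m => ∑ q, b q m q) i

/-- `solveSystem` does solve the system, and it is the only solution. -/
theorem solveSystem_iff {n : ℕ} (c : Matrix (Fin n) (Fin n) ℝ) (hc : IsUnit (1 + c).det)
    (b a : Fin n → Fin n → Fin n → ℝ) :
    (∀ i j k, a i j k + c j k * ∑ q, a q i q = b i j k) ↔ a = solveSystem c b := by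
  constructor
  · intro h
    have h1 : (1 + c) *ᵥ (fun m => ∑ q, a q m q) = fun m => ∑ q, b q m q := by
      funext m
      rw [Matrix.add_mulVec, Matrix.one_mulVec, Pi.add_apply]
      simp only [← h, Finset.sum_add_distrib, Matrix.mulVec, dotProduct]
    funext i j k
    have h2 : (1 + c)⁻¹ *ᵥ (fun m => ∑ q, b q m q) = fun m => ∑ q, a q m q := by
      rw [← h1, Matrix.mulVec_mulVec, Matrix.nonsing_inv_mul _ hc, Matrix.one_mulVec]
    simp only [solveSystem, h2, ← h i j k]
    ring
  · rintro rfl i j k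
    set u := (1 + c)⁻¹ *ᵥ (fun m => ∑ q, b q m q) with hu
    have h1 : (1 + c) *ᵥ u = fun m => ∑ q, b q m q := by
      rw [hu, Matrix.mulVec_mulVec, Matrix.mul_nonsing_inv _ hc, Matrix.one_mulVec]
    have h2 : ∑ q, solveSystem c b q i q = u i := by
      have h3 := congrFun h1 i
      rw [Matrix.add_mulVec, Matrix.one_mulVec, Pi.add_apply] at h3
      simp only [Matrix.mulVec, dotProduct] at h3
      simp only [solveSystem, ← hu, Finset.sum_sub_distrib]
      linarith
    rw [h2]
    simp only [solveSystem, ← hu]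
    ring

/-- The approximate second fundamental form `A^{V,ε}_{ijk}(x)`: the solution of the system with
matrix `c^{V,ε}(x)` and right-hand side `β^{V,ε}(x)`. -/
def Varifold.aApprox {d n : ℕ} {Ω : Set (E n)} (V : Varifold d n Ω) (ρ ξ η : ℝ → ℝ) (ε : ℝ)
    (x : E n) (i j k : Fin n) : ℝ :=
  solveSystem (V.cApprox η ε x) (V.betaApprox ρ ξ ε x) i j k

end WSFF

end

/-!
At a point `x` where the rectifiable varifold `V` has an approximate tangent plane and positive
multiplicity, the blow-ups of `‖V‖` show that `‖V‖ (B_{3ε}(x))` is at most `Λ εⁿ (‖V‖ ∗ f_ε)(x)` for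
every small `ε`, where `f` is `ξ` or `η` and `Λ` depends only on `f` and the dimensions
(`exists_forall_isDominated`); that `Λ` depends neither on the point nor on the plane comes from the
fact that radial functions have the same integral over all `d`-planes (`integral_plane_norm`).
Almost every such `x` also lies in the support of `‖V‖`, so the flat-distance hypothesis applies to
the balls centred at `x`, and these are the only balls needed.

All numerators and denominators of `β` and `c` are integrals of a fixed test function recentred
at `x` or at `z_h`. If a test function at scale `ε` is bounded by `K` and `K`-Lipschitz, then
passing from `(V, x)` to `(W_h, z_h)` changes its integral by at most
`K (δ_h + |x - z_h|) ‖V‖ (B_{3ε}(x))` (`IsKernel.abs_integral_sub_le`): the flat distance handles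
the change of varifold, the Lipschitz bound handles the translation. The constant `K` is of order
`ε⁻ⁿ⁻¹` for the kernels `ξ_ε`, `S_{jk} η_ε`, and of order `ε⁻ⁿ⁻²` times `‖ρ‖_{W^{2,∞}}` for the
kernel `S_{jk} (S ∇ρ_ε)_i`; the gradient of the radial function `ρ_ε` is Lipschitz at the origin
because `ρ'(0) = 0` (`norm_radial_sub_radial_le`). Dividing by denominators that dominate
`‖V‖ (B_{3ε}(x))` gives the estimates on `c` and `β` as long as `(δ_h + |x - z_h|) / ε_h` stays
below `κ`, which also keeps the denominators for `W_h` positive. When it exceeds `κ`, the estimate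
on `c` is trivial, since its entries are bounded by `1` and `‖ρ‖_{W^{1,∞}}` is bounded below
(`IsRho.ofReal_inv_le_normW1`). The factor `C_ξ / C_ρ` is bounded uniformly in `ρ`
(`IsRho.le_kernelConst`).

Finally `c` is an average of orthogonal projections, so its quadratic form is non-negative and
`(I + c)⁻¹` does not increase Euclidean norms; with the resolvent identity this transfers the
estimates on `c` and `β` to `A` (`abs_solveSystem_sub_le`).
-/

namespace WSFF

/-! ### Orthogonal projections -/

theorem Grass.inner_left {d n : ℕ} (S : Grass d n) (v w : E n) :
    inner ℝ (S.1 v) w = inner ℝ v (S.1 w) :=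
  (ContinuousLinearMap.isSelfAdjoint_iff_isSymmetric.1 S.2.1) v w

theorem Grass.apply_apply {d n : ℕ} (S : Grass d n) (v : E n) : S.1 (S.1 v) = S.1 v := by
  conv_rhs => rw [← S.2.2.1]
  rfl

theorem Grass.norm_apply_le {d n : ℕ} (S : Grass d n) (v : E n) : ‖S.1 v‖ ≤ ‖v‖ := by
  have h : ‖S.1 v‖ * ‖S.1 v‖ ≤ ‖v‖ * ‖S.1 v‖ := by
    rw [← real_inner_self_eq_norm_mul_norm, S.inner_left, S.apply_apply]
    exact real_inner_le_norm _ _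
  rcases (norm_nonneg (S.1 v)).eq_or_lt with h0 | h0
  · rw [← h0]; exact norm_nonneg v
  · exact le_of_mul_le_mul_right h h0

theorem Grass.abs_entry_le_one {d n : ℕ} (S : Grass d n) (j k : Fin n) : |S.entry j k| ≤ 1 := by
  have h := (PiLp.norm_apply_le (S.1 (EuclideanSpace.single k 1)) j).trans (S.norm_apply_le _)
  simpa [Grass.entry] using h

theorem Grass.abs_apply_sub_le {d n : ℕ} (S T : Grass d n) (v : E n) (i : Fin n) :
    |S.1 v i - T.1 v i| ≤ dist S T * ‖v‖ := by
  have h := (PiLp.norm_apply_le ((S.1 - T.1) v) i).trans ((S.1 - T.1).le_opNorm v)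
  rw [Subtype.dist_eq, dist_eq_norm]
  simpa using h

theorem Grass.abs_entry_sub_le {d n : ℕ} (S T : Grass d n) (j k : Fin n) :
    |S.entry j k - T.entry j k| ≤ dist S T := by
  simpa [Grass.entry] using S.abs_apply_sub_le T (EuclideanSpace.single k 1) j

theorem Grass.sum_entry_mul {d n : ℕ} (S : Grass d n) (v : E n) (j : Fin n) :
    ∑ k, S.entry j k * v k = S.1 v j := by
  conv_rhs => rw [← (EuclideanSpace.basisFun (Fin n) ℝ).sum_repr v]
  simp [Grass.entry, map_sum, mul_comm]

/-- The quadratic form `v ↦ S v · v = |S v|²` of a projection is non-negative. -/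
theorem Grass.sum_mul_sum_entry_nonneg {d n : ℕ} (S : Grass d n) (v : Fin n → ℝ) :
    0 ≤ ∑ j, v j * ∑ k, S.entry j k * v k := by
  have h : ∑ j, v j * ∑ k, S.entry j k * v k
      = inner ℝ (S.1 (WithLp.toLp 2 v)) (WithLp.toLp 2 v) := by
    rw [PiLp.inner_apply]
    refine Finset.sum_congr rfl fun j _ => ?_
    rw [← S.sum_entry_mul]
    simp
  rw [h, ← S.apply_apply, S.inner_left, real_inner_self_eq_norm_mul_norm]
  positivity

/-! ### Test functions and the flat distance -/

/-- A test function centred at the origin: bounded by `K`, `K`-Lipschitz for the maximum distance,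
and zero above the complement of the closed ball of radius `ε`. -/
structure IsKernel {d n : ℕ} (K ε : ℝ) (φ : E n × Grass d n → ℝ) : Prop where
  abs_le : ∀ p, |φ p| ≤ K
  abs_sub_le : ∀ p q, |φ p - φ q| ≤ K * dist p q
  eq_zero : ∀ p, ε < ‖p.1‖ → φ p = 0

/-- The test function `φ` recentred at `z`. -/
def recentre {d n : ℕ} (φ : E n × Grass d n → ℝ) (z : E n) (p : E n × Grass d n) : ℝ :=
  φ (p.1 - z, p.2)

theorem IsKernel.lipschitzWith {d n : ℕ} {K ε : ℝ} {φ : E n × Grass d n → ℝ}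
    (hφ : IsKernel K ε φ) (hK : 0 ≤ K) (z : E n) : LipschitzWith K.toNNReal (recentre φ z) := by
  refine LipschitzWith.of_dist_le_mul fun p q => ?_
  rw [Real.coe_toNNReal _ hK, Real.dist_eq]
  refine (hφ.abs_sub_le _ _).trans_eq ?_
  simp [Prod.dist_eq]

theorem IsKernel.recentre_eq_zero {d n : ℕ} {K ε : ℝ} {φ : E n × Grass d n → ℝ}
    (hφ : IsKernel K ε φ) {z : E n} {p : E n × Grass d n} (hp : ε < dist p.1 z) :
    recentre φ z p = 0 :=
  hφ.eq_zero _ (by rwa [dist_eq_norm] at hp)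

theorem Varifold.integrable_of_bounded {d n : ℕ} {Ω : Set (E n)} (V : Varifold d n Ω)
    {φ : E n × Grass d n → ℝ} (hc : Continuous φ) {M : ℝ} (hM : ∀ p, |φ p| ≤ M) {z : E n} {r : ℝ}
    (hz : Metric.closedBall z r ⊆ Ω) (h0 : ∀ p, r < dist p.1 z → φ p = 0) :
    Integrable φ V.measure := by
  have hfin := V.finite_on_compacts _ (isCompact_closedBall z r) hz
  have h1 : IntegrableOn φ (Metric.closedBall z r ×ˢ univ) V.measure :=
    Measure.integrableOn_of_bounded hfin.ne hc.aestronglyMeasurable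
      (M := M) (Eventually.of_forall hM)
  refine (integrableOn_iff_integrable_of_support_subset fun p hp => ?_).1 h1
  refine ⟨?_, mem_univ _⟩
  by_contra h
  exact hp (h0 p (not_le.1 h))

theorem IsKernel.integrable {d n : ℕ} {K ε : ℝ} {φ : E n × Grass d n → ℝ}
    (hφ : IsKernel K ε φ) (hK : 0 ≤ K) {Ω : Set (E n)} (V : Varifold d n Ω) {z : E n}
    (hz : Metric.closedBall z ε ⊆ Ω) : Integrable (recentre φ z) V.measure :=
  V.integrable_of_bounded (hφ.lipschitzWith hK z).continuous (fun _ => hφ.abs_le _) hz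
    fun _ hp => hφ.recentre_eq_zero hp

theorem Varifold.mass_apply {d n : ℕ} {Ω : Set (E n)} (V : Varifold d n Ω) {s : Set (E n)}
    (hs : MeasurableSet s) : V.mass s = V.measure (s ×ˢ univ) := by
  rw [Varifold.mass, Measure.map_apply measurable_fst hs, prod_univ]

theorem Varifold.mass_closedBall_lt_top {d n : ℕ} {Ω : Set (E n)} (V : Varifold d n Ω) {x : E n}
    {r : ℝ} (h : Metric.closedBall x r ⊆ Ω) : V.mass (Metric.closedBall x r) < ∞ := by
  rw [V.mass_apply Metric.isClosed_closedBall.measurableSet]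
  exact V.finite_on_compacts _ (isCompact_closedBall x r) h

theorem Varifold.abs_integral_le {d n : ℕ} {Ω : Set (E n)} (V : Varifold d n Ω)
    {φ : E n × Grass d n → ℝ} {M : ℝ} (hM : ∀ p, |φ p| ≤ M) {x : E n} {r : ℝ}
    (hfin : V.mass (Metric.ball x r) < ∞) (h0 : ∀ p, r ≤ dist p.1 x → φ p = 0) :
    |∫ p, φ p ∂V.measure| ≤ M * V.mass.real (Metric.ball x r) := by
  rw [V.mass_apply Metric.isOpen_ball.measurableSet] at hfin
  rw [measureReal_def, V.mass_apply Metric.isOpen_ball.measurableSet, ← measureReal_def,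
    ← setIntegral_eq_integral_of_forall_compl_eq_zero (s := Metric.ball x r ×ˢ univ)]
  · exact norm_setIntegral_le_of_norm_le_const (f := φ) hfin fun p _ => hM p
  · intro p hp
    refine h0 p (not_lt.1 fun h => hp ⟨h, mem_univ _⟩)

theorem abs_integral_sub_le_of_flatDist_le {d n : ℕ} {Ω : Set (E n)} {V W : Varifold d n Ω}
    {x : E n} {r r' K δ : ℝ} {m : ℝ≥0∞} (hr : r' < r) (hΩ : Metric.closedBall x r' ⊆ Ω)
    (hflat : flatDist (Metric.ball x r) V W ≤ ENNReal.ofReal δ * m) (hm : m ≠ ∞) (hδ : 0 ≤ δ)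
    (hK : 0 ≤ K) {φ : E n × Grass d n → ℝ} (hL : LipschitzWith K.toNNReal φ)
    (hM : ∀ p, |φ p| ≤ K) (h0 : ∀ p, r' < dist p.1 x → φ p = 0) :
    |∫ p, φ p ∂V.measure - ∫ p, φ p ∂W.measure| ≤ K * (δ * m.toReal) := by
  rcases hK.eq_or_lt with rfl | hK
  · have h : φ = fun _ => 0 := funext fun p => abs_nonpos_iff.1 (hM p)
    simp [h]
  have hiV := V.integrable_of_bounded hL.continuous hM hΩ h0
  have hiW := W.integrable_of_bounded hL.continuous hM hΩ h0
  have htest : IsFlatTest Ω (Metric.ball x r) (fun p => K⁻¹ * φ p) := by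
    refine ⟨LipschitzWith.lipschitzOnWith (LipschitzWith.of_dist_le_mul fun p q => ?_),
      fun p _ => ?_, ?_⟩
    · have := hL.dist_le_mul p q
      rw [Real.coe_toNNReal _ hK.le, Real.dist_eq] at this
      rw [Real.dist_eq, ← mul_sub, abs_mul, abs_of_pos (inv_pos.2 hK), NNReal.coe_one, one_mul,
        inv_mul_le_iff₀ hK]
      exact this
    · rw [abs_mul, abs_of_pos (inv_pos.2 hK), inv_mul_le_iff₀ hK, mul_one]
      exact hM p
    · have hcl : IsClosed (Metric.closedBall x r' ×ˢ (univ : Set (Grass d n))) :=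
        Metric.isClosed_closedBall.prod isClosed_univ
      refine inter_subset_left.trans ((closure_minimal ?_ hcl).trans
        (prod_mono (Metric.closedBall_subset_ball hr) subset_rfl))
      rintro p ⟨hp, -⟩
      refine ⟨Metric.mem_closedBall.2 (not_lt.1 fun h => hp ?_), mem_univ _⟩
      simp [h0 p h]
  have hle : ENNReal.ofReal |∫ p, K⁻¹ * φ p ∂V.measure - ∫ p, K⁻¹ * φ p ∂W.measure|
      ≤ ENNReal.ofReal δ * m := by
    refine le_trans ?_ hflat
    unfold flatDist
    exact le_iSup_of_le _ (le_iSup_of_le htest (le_iSup_of_le (hiV.const_mul _)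
      (le_iSup_of_le (hiW.const_mul _) le_rfl)))
  rw [integral_const_mul, integral_const_mul, ← mul_sub, abs_mul, abs_of_pos (inv_pos.2 hK)] at hle
  have h2 := ENNReal.toReal_mono (ENNReal.mul_ne_top ENNReal.ofReal_ne_top hm) hle
  rw [ENNReal.toReal_ofReal (by positivity), ENNReal.toReal_mul, ENNReal.toReal_ofReal hδ,
    inv_mul_le_iff₀ hK] at h2
  exact h2

/-- The comparison underlying all estimates: moving from `(V, x)` to `(W, z)` changes the integral
of a test function at scale `ε` by its size times the flat error plus the displacement, measured
by the mass of `V` in a ball of comparable radius. The radius `5ε/2` leaves room for the test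
function recentred at `z`, which lives in the ball of radius `2ε` about `x`. -/
theorem IsKernel.abs_integral_sub_le {d n : ℕ} {K ε : ℝ} {φ : E n × Grass d n → ℝ}
    (hφ : IsKernel K ε φ) (hK : 0 ≤ K) (hε : 0 < ε) {Ω : Set (E n)} {V W : Varifold d n Ω}
    {x z : E n} {δ : ℝ} (hδ : 0 ≤ δ) (hxz : dist x z ≤ ε) (hΩ : Metric.closedBall x (3 * ε) ⊆ Ω)
    (hflat : flatDist (Metric.ball x (5 / 2 * ε)) V W
      ≤ ENNReal.ofReal δ * V.mass (Metric.ball x (3 * ε))) :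
    |∫ p, recentre φ z p ∂W.measure - ∫ p, recentre φ x p ∂V.measure|
      ≤ K * (δ + dist x z) * V.mass.real (Metric.ball x (3 * ε)) := by
  have hfin : V.mass (Metric.ball x (3 * ε)) < ∞ :=
    (measure_mono Metric.ball_subset_closedBall).trans_lt (V.mass_closedBall_lt_top hΩ)
  have hz0 : ∀ p : E n × Grass d n, 2 * ε < dist p.1 x → recentre φ z p = 0 := fun p hp =>
    hφ.recentre_eq_zero (by linarith [dist_triangle p.1 z x, dist_comm x z])
  have hx0 : ∀ p : E n × Grass d n, 2 * ε < dist p.1 x → recentre φ x p = 0 := fun p hp =>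
    hφ.recentre_eq_zero (by linarith)
  have hΩ2 : Metric.closedBall x (2 * ε) ⊆ Ω :=
    (Metric.closedBall_subset_closedBall (by linarith)).trans hΩ
  have h1 := abs_integral_sub_le_of_flatDist_le (by linarith : 2 * ε < 5 / 2 * ε) hΩ2 hflat
    hfin.ne hδ hK (hφ.lipschitzWith hK z) (fun p => hφ.abs_le _) hz0
  have hiz : Integrable (recentre φ z) V.measure :=
    V.integrable_of_bounded (hφ.lipschitzWith hK z).continuous (fun p => hφ.abs_le _) hΩ2 hz0
  have hix : Integrable (recentre φ x) V.measure :=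
    V.integrable_of_bounded (hφ.lipschitzWith hK x).continuous (fun p => hφ.abs_le _) hΩ2 hx0
  have h2 : |∫ p, (recentre φ z p - recentre φ x p) ∂V.measure|
      ≤ K * dist x z * V.mass.real (Metric.ball x (3 * ε)) := by
    refine V.abs_integral_le (fun p => ?_) hfin fun p hp => ?_
    · refine (hφ.abs_sub_le _ _).trans_eq ?_
      rw [Prod.dist_eq, dist_self, dist_sub_left, max_eq_left dist_nonneg, dist_comm]
    · rw [hz0 p (by linarith), hx0 p (by linarith), sub_zero]
  rw [integral_sub hiz hix] at h2
  rw [← measureReal_def] at h1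
  rw [_root_.abs_le] at h1 h2 ⊢
  constructor <;> nlinarith [h1.1, h1.2, h2.1, h2.2]

/-! ### Profiles and the blow-up of the mass -/

/-- Every profile is bounded and Lipschitz on `[0, ∞)`, with one constant for both. -/
theorem IsProfile.exists_bound {f : ℝ → ℝ} (hf : IsProfile f) :
    ∃ K : ℝ, 0 < K ∧ (∀ t, 0 ≤ t → |f t| ≤ K) ∧
      ∀ s t, 0 ≤ s → 0 ≤ t → |f s - f t| ≤ K * |s - t| := by
  obtain ⟨K, hK⟩ := (hf.contDiffOn.mono Icc_subset_Ici_self).exists_lipschitzOnWith one_ne_zero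
    (convex_Icc (0 : ℝ) 1) isCompact_Icc
  have hmin : ∀ t, f t = f (min t 1) := fun t => by
    rcases le_total t 1 with h | h
    · rw [min_eq_left h]
    · rw [min_eq_right h, hf.eq_zero t h, hf.eq_zero 1 le_rfl]
  have hlip : ∀ s t, 0 ≤ s → 0 ≤ t → |f s - f t| ≤ K * |min s 1 - min t 1| := fun s t hs ht => by
    rw [hmin s, hmin t]
    exact hK.dist_le_mul _ ⟨le_min hs zero_le_one, min_le_right _ _⟩ _
      ⟨le_min ht zero_le_one, min_le_right _ _⟩
  have hK0 : (0 : ℝ) ≤ K := K.2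
  refine ⟨K + 1, by positivity, fun t ht => ?_, fun s t hs ht => ?_⟩
  · have h := hlip t 1 ht zero_le_one
    rw [hf.eq_zero 1 le_rfl, sub_zero, min_self] at h
    have h3 : |min t 1 - 1| ≤ 1 := by
      rw [abs_le]
      constructor <;> linarith [le_min ht zero_le_one, min_le_right t 1]
    nlinarith
  · have h := hlip s t hs ht
    have h3 : |min s 1 - min t 1| ≤ |s - t| := by
      simpa using abs_min_sub_min_le_max s 1 t 1
    nlinarith [abs_nonneg (s - t)]

/-- The integral of a radial function over a `d`-plane does not depend on the plane. -/
theorem integral_plane_norm {d n : ℕ} {f : ℝ → ℝ} (hf : Continuous fun y : E n => f ‖y‖)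
    (T : Grass d n) :
    ∫ y in T.plane, f ‖y‖ ∂(hausdorff d n)
      = omega d / 2 ^ d * ∫ y : E d, f ‖y‖ ∂(Measure.hausdorffMeasure (d : ℝ)) := by
  have hfr : Module.finrank ℝ (LinearMap.range (T.1 : E n →ₗ[ℝ] E n)) = d := T.2.2.2
  let b := (stdOrthonormalBasis ℝ (LinearMap.range (T.1 : E n →ₗ[ℝ] E n))).reindex
    (finCongr hfr)
  let ι : E d →ₗᵢ[ℝ] E n :=
    (LinearMap.range (T.1 : E n →ₗ[ℝ] E n)).subtypeₗᵢ.comp b.repr.symm.toLinearIsometry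
  have hι : range ι = T.plane := by
    have h1 : (ι : E d → E n) = Subtype.val ∘ b.repr.symm := rfl
    rw [h1, range_comp, b.repr.symm.surjective.range_eq, image_univ, Subtype.range_coe]
    rfl
  have hω : 0 ≤ omega d / 2 ^ d := div_nonneg ENNReal.toReal_nonneg (by positivity)
  rw [hausdorff, Measure.restrict_smul, integral_smul_measure, ← hι,
    ← ι.isometry.map_hausdorffMeasure (Or.inl (Nat.cast_nonneg d)),
    integral_map ι.continuous.aemeasurable hf.aestronglyMeasurable, ENNReal.toReal_ofReal hω,
    smul_eq_mul]
  simp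

theorem omega_pos (d : ℕ) : 0 < omega d :=
  ENNReal.toReal_pos (Metric.measure_ball_pos volume _ one_pos).ne' measure_ball_lt_top.ne

theorem continuous_comp_norm {n : ℕ} {f : ℝ → ℝ} (hf : ContinuousOn f (Ici 0)) :
    Continuous fun y : E n => f ‖y‖ :=
  hf.comp_continuous continuous_norm fun y => norm_nonneg y

theorem hasCompactSupport_comp_norm {n : ℕ} {f : ℝ → ℝ} {R : ℝ} (h0 : ∀ t, R ≤ t → f t = 0) :
    HasCompactSupport fun y : E n => f ‖y‖ := by
  refine HasCompactSupport.intro (isCompact_closedBall (0 : E n) R) fun y hy => h0 _ ?_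
  rw [mem_closedBall_zero_iff, not_le] at hy
  exact hy.le

/-- The common value of the integral over `d`-planes is positive for a profile that is not zero. -/
theorem integral_norm_hausdorff_pos {d : ℕ} (hd : 1 ≤ d) {f : ℝ → ℝ}
    (hf : ContinuousOn f (Ici 0)) (hnn : ∀ t, 0 ≤ t → 0 ≤ f t) {R : ℝ}
    (h0 : ∀ t, R ≤ t → f t = 0) (hne : ∃ t, 0 ≤ t ∧ f t ≠ 0) :
    0 < omega d / 2 ^ d * ∫ y : E d, f ‖y‖ ∂(Measure.hausdorffMeasure (d : ℝ)) := by
  refine mul_pos (div_pos (omega_pos d) (by positivity)) ?_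
  obtain ⟨t, ht, hft⟩ := hne
  have hH : (Measure.hausdorffMeasure (d : ℝ) : Measure (E d)).IsAddHaarMeasure := by
    have := isAddHaarMeasure_hausdorffMeasure (E := E d)
    rwa [finrank_euclideanSpace_fin] at this
  have : Nontrivial (E d) := by
    have : Nonempty (Fin d) := ⟨⟨0, hd⟩⟩
    infer_instance
  obtain ⟨y, hy⟩ := exists_norm_eq (E d) ht
  exact (continuous_comp_norm hf).integral_pos_of_hasCompactSupport_nonneg_nonzero
    (hasCompactSupport_comp_norm h0) (fun y => hnn _ (norm_nonneg y)) (x := y) (by rwa [hy])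

/-- A cutoff equal to `1` on `[0, 3]` and to `0` on `[4, ∞)`. -/
def cutoff (t : ℝ) : ℝ := max 0 (min 1 (4 - t))

theorem continuous_cutoff : Continuous cutoff := by unfold cutoff; fun_prop

theorem cutoff_nonneg (t : ℝ) : 0 ≤ cutoff t := le_max_left _ _

theorem cutoff_le_one (t : ℝ) : cutoff t ≤ 1 := max_le zero_le_one (min_le_left _ _)

theorem cutoff_eq_one {t : ℝ} (ht : t ≤ 3) : cutoff t = 1 := by
  rw [cutoff, min_eq_left (by linarith), max_eq_right zero_le_one]

theorem cutoff_eq_zero {t : ℝ} (ht : 4 ≤ t) : cutoff t = 0 := by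
  rw [cutoff, max_eq_left]
  exact (min_le_right _ _).trans (by linarith)

/-- At a point with positive multiplicity and an approximate tangent plane, the mass of the ball of
radius `3ε` is controlled by the mass weighted with a profile at scale `ε`, with a constant that
depends only on the profile and on `d`: both quantities divided by `ε ^ d` converge to the
multiplicity times a constant. -/
theorem exists_forall_isApproxTangent_eventually {d : ℕ} (n : ℕ) (hd : 1 ≤ d) {f : ℝ → ℝ}
    (hf : IsEta f) :
    ∃ Λ : ℝ, 0 < Λ ∧ ∀ (M : Set (E n)) (θ : E n → ℝ≥0) (x : E n) (T : Grass d n),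
      0 < θ x → IsApproxTangent M θ x T →
      (∃ r, 0 < r ∧ weighted d M θ (Metric.closedBall x r) < ∞) →
      ∀ᶠ ε in 𝓝[>] (0 : ℝ), 0 < ∫ y, f (‖y - x‖ / ε) ∂(weighted d M θ) ∧
        (weighted d M θ).real (Metric.ball x (3 * ε))
          ≤ Λ * ∫ y, f (‖y - x‖ / ε) ∂(weighted d M θ) := by
  have hfc := hf.contDiffOn.continuousOn
  set m := omega d / 2 ^ d * ∫ y : E d, f ‖y‖ ∂(Measure.hausdorffMeasure (d : ℝ)) with hm
  set m' := omega d / 2 ^ d * ∫ y : E d, cutoff ‖y‖ ∂(Measure.hausdorffMeasure (d : ℝ)) with hm'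
  have hmpos : 0 < m := integral_norm_hausdorff_pos hd hfc hf.nonneg hf.eq_zero hf.ne_zero
  have hmpos' : 0 < m' := integral_norm_hausdorff_pos hd continuous_cutoff.continuousOn
    (fun t _ => cutoff_nonneg t) (fun t => cutoff_eq_zero)
    ⟨0, le_rfl, by rw [cutoff_eq_one (by norm_num)]; exact one_ne_zero⟩
  refine ⟨4 * m' / m, by positivity, fun M θ x T hθ hT ⟨r, hr, hfin⟩ => ?_⟩
  set μ := weighted d M θ
  have hθ' : (0 : ℝ) < θ x := hθ
  have h1 := hT _ (continuous_comp_norm hfc) (hasCompactSupport_comp_norm hf.eq_zero)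
  rw [integral_plane_norm (continuous_comp_norm hfc), ← hm] at h1
  have h2 := hT _ (continuous_comp_norm continuous_cutoff.continuousOn)
    (hasCompactSupport_comp_norm fun t => cutoff_eq_zero)
  rw [integral_plane_norm (continuous_comp_norm continuous_cutoff.continuousOn), ← hm'] at h2
  have h1' := h1.eventually (lt_mem_nhds (by
    have : 0 < (θ x : ℝ) * m := by positivity
    linarith : (θ x : ℝ) * m / 2 < θ x * m))
  have h2' := h2.eventually (gt_mem_nhds (by
    have : 0 < (θ x : ℝ) * m' := by positivity
    linarith : (θ x : ℝ) * m' < 2 * (θ x * m')))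
  have h3 : ∀ᶠ ε in 𝓝[>] (0 : ℝ), 4 * ε < r := by
    have : Tendsto (fun ε : ℝ => 4 * ε) (𝓝[>] 0) (𝓝 0) := by
      exact ((continuous_const_mul (4 : ℝ)).tendsto' 0 0 (mul_zero 4)).mono_left
        nhdsWithin_le_nhds
    exact this.eventually (gt_mem_nhds hr)
  filter_upwards [h1', h2', h3, self_mem_nhdsWithin] with ε h1 h2 h3 hε
  rw [mem_Ioi] at hε
  have hnorm : ∀ y : E n, ‖ε⁻¹ • (y - x)‖ = ‖y - x‖ / ε := fun y => by
    rw [norm_smul, norm_inv, Real.norm_of_nonneg hε.le, inv_mul_eq_div]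
  simp only [hnorm] at h1 h2
  have hεd : 0 < ε ^ d := by positivity
  rw [lt_inv_mul_iff₀ hεd] at h1
  rw [inv_mul_lt_iff₀ hεd] at h2
  have hball : μ.real (Metric.ball x (3 * ε)) ≤ ∫ y, cutoff (‖y - x‖ / ε) ∂μ := by
    have hsub : Metric.ball x (3 * ε) ⊆ Metric.closedBall x r := fun y hy => by
      rw [Metric.mem_ball] at hy
      rw [Metric.mem_closedBall]
      linarith
    have hfin3 : μ (Metric.ball x (3 * ε)) < ∞ := (measure_mono hsub).trans_lt hfin
    rw [← integral_indicator_one Metric.isOpen_ball.measurableSet]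
    have hcont : Continuous fun y : E n => cutoff (‖y - x‖ / ε) := by
      have := continuous_cutoff
      fun_prop
    refine integral_mono ?_ ?_ fun y => ?_
    · exact (integrable_indicator_iff Metric.isOpen_ball.measurableSet).2
        (integrableOn_const hfin3.ne)
    · refine (integrableOn_iff_integrable_of_support_subset (s := Metric.closedBall x r)
        fun y hy => ?_).1 (Measure.integrableOn_of_bounded hfin.ne hcont.aestronglyMeasurable
          (M := 1) (Eventually.of_forall fun y => ?_))
      · by_contra h
        refine hy (cutoff_eq_zero ?_)
        rw [Metric.mem_closedBall, not_le, dist_eq_norm] at h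
        rw [le_div_iff₀ hε]
        linarith
      · rw [Real.norm_of_nonneg (cutoff_nonneg _)]
        exact cutoff_le_one _
    · by_cases hy : y ∈ Metric.ball x (3 * ε)
      · rw [indicator_of_mem hy, cutoff_eq_one]
        · rfl
        · rw [Metric.mem_ball, dist_eq_norm] at hy
          exact ((div_lt_iff₀ hε).2 hy).le
      · rw [indicator_of_notMem hy]
        exact cutoff_nonneg _
  refine ⟨lt_trans (by positivity) h1, hball.trans (h2.le.trans ?_)⟩
  calc ε ^ d * (2 * (θ x * m')) = 4 * m' / m * (ε ^ d * (θ x * m / 2)) := by field_simp; ring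
    _ ≤ _ := by gcongr

/-! ### The test functions attached to the profiles -/

theorem isKernel_rescale {d n : ℕ} {f : ℝ → ℝ} (hf : IsProfile f) {K : ℝ} (hK : 0 ≤ K)
    (hb : ∀ t, 0 ≤ t → |f t| ≤ K) (hl : ∀ s t, 0 ≤ s → 0 ≤ t → |f s - f t| ≤ K * |s - t|)
    {ε : ℝ} (hε : 0 < ε) (hε1 : ε ≤ 1) :
    IsKernel (d := d) (n := n) (K * (ε ^ (n + 1))⁻¹) ε (fun p => rescale n f ε p.1) := by
  have hεn : 0 < (ε ^ n)⁻¹ := by positivity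
  refine ⟨fun p => ?_, fun p q => ?_, fun p hp => ?_⟩
  · have h := hb (‖p.1‖ / ε) (by positivity)
    rw [rescale, abs_mul, abs_of_pos hεn, mul_comm]
    gcongr ?_ * ?_⁻¹
    exact pow_le_pow_of_le_one hε.le hε1 n.le_succ
  · have h := hl (‖p.1‖ / ε) (‖q.1‖ / ε) (by positivity) (by positivity)
    rw [rescale, rescale, ← mul_sub, abs_mul, abs_of_pos hεn]
    have h2 : |‖p.1‖ / ε - ‖q.1‖ / ε| ≤ dist p q / ε := by
      rw [← sub_div, abs_div, abs_of_pos hε]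
      gcongr
      refine (abs_norm_sub_norm_le _ _).trans ?_
      rw [← dist_eq_norm]
      exact le_max_left _ _
    calc (ε ^ n)⁻¹ * |f (‖p.1‖ / ε) - f (‖q.1‖ / ε)|
        ≤ (ε ^ n)⁻¹ * (K * (dist p q / ε)) := by
          gcongr
          exact h.trans (by gcongr)
      _ = K * (ε ^ (n + 1))⁻¹ * dist p q := by rw [pow_succ, mul_inv]; ring
  · rw [rescale, hf.eq_zero _ ((one_le_div hε).2 hp.le), mul_zero]

theorem IsKernel.entry_mul {d n : ℕ} {K ε : ℝ} {φ : E n × Grass d n → ℝ}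
    (hφ : IsKernel K ε φ) (j k : Fin n) :
    IsKernel (2 * K) ε (fun p => p.2.entry j k * φ p) := by
  refine ⟨fun p => ?_, fun p q => ?_, fun p hp => ?_⟩
  · have h := hφ.abs_le p
    have := p.2.abs_entry_le_one j k
    rw [abs_mul]
    nlinarith [abs_nonneg (φ p)]
  · have h1 := p.2.abs_entry_le_one j k
    have h2 := (p.2.abs_entry_sub_le q.2 j k).trans (le_max_right (dist p.1 q.1) _)
    rw [← Prod.dist_eq] at h2
    have h3 := hφ.abs_sub_le p q
    have h4 := hφ.abs_le q
    have h5 : p.2.entry j k * φ p - q.2.entry j k * φ q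
        = p.2.entry j k * (φ p - φ q) + (p.2.entry j k - q.2.entry j k) * φ q := by ring
    rw [h5]
    refine (abs_add_le _ _).trans ?_
    rw [abs_mul, abs_mul]
    calc |p.2.entry j k| * |φ p - φ q| + |p.2.entry j k - q.2.entry j k| * |φ q|
        ≤ 1 * (K * dist p q) + dist p q * K := by gcongr
      _ = 2 * K * dist p q := by ring
  · simp only [hφ.eq_zero p hp, mul_zero]

theorem isKernel_apply {d n : ℕ} {K ε : ℝ} {G : E n → E n} (hb : ∀ y, ‖G y‖ ≤ K)
    (hl : ∀ y y', ‖G y - G y'‖ ≤ K * dist y y') (h0 : ∀ y, ε < ‖y‖ → G y = 0) (i : Fin n) :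
    IsKernel (d := d) (2 * K) ε (fun p => (p.2.1 (G p.1)) i) := by
  have hK : 0 ≤ K := (norm_nonneg _).trans (hb 0)
  refine ⟨fun p => ?_, fun p q => ?_, fun p hp => ?_⟩
  · have h := ((PiLp.norm_apply_le (p.2.1 (G p.1)) i).trans (p.2.norm_apply_le _)).trans (hb p.1)
    rw [Real.norm_eq_abs] at h
    linarith
  · have h1 := (PiLp.norm_apply_le (p.2.1 (G p.1 - G q.1)) i).trans
      ((p.2.norm_apply_le _).trans (hl p.1 q.1))
    have h2 := p.2.abs_apply_sub_le q.2 (G q.1) i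
    have h3 : dist p.1 q.1 ≤ dist p q := le_max_left _ _
    have h4 : dist p.2 q.2 ≤ dist p q := le_max_right _ _
    have h5 : p.2.1 (G p.1) i - q.2.1 (G q.1) i
        = (p.2.1 (G p.1 - G q.1)) i + (p.2.1 (G q.1) i - q.2.1 (G q.1) i) := by
      rw [map_sub, PiLp.sub_apply]; ring
    rw [h5]
    refine (abs_add_le _ _).trans ?_
    rw [Real.norm_eq_abs] at h1
    calc _ ≤ K * dist p.1 q.1 + dist p.2 q.2 * ‖G q.1‖ := add_le_add h1 h2
      _ ≤ K * dist p q + dist p q * K := by gcongr; exact hb _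
      _ = 2 * K * dist p q := by ring
  · simp [h0 _ hp]

/-- The radial vector field `y ↦ g(|y|) y / |y|` (zero at the origin). -/
noncomputable def radial {n : ℕ} (g : ℝ → ℝ) (y : E n) : E n := g ‖y‖ • (‖y‖⁻¹ • y)

theorem norm_radial_le {n : ℕ} {g : ℝ → ℝ} (y : E n) : ‖radial g y‖ ≤ |g ‖y‖| := by
  have h : ‖‖y‖⁻¹ • y‖ ≤ 1 := by
    rw [norm_smul, norm_inv, norm_norm]
    exact inv_mul_le_one
  rw [radial, norm_smul, Real.norm_eq_abs]
  nlinarith [abs_nonneg (g ‖y‖)]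

/-- A radial vector field whose profile is Lipschitz and vanishes at `0` is Lipschitz. -/
theorem norm_radial_sub_radial_le {n : ℕ} {g : ℝ → ℝ} {R : ℝ} (h0 : g 0 = 0)
    (hl : ∀ s t, 0 ≤ s → 0 ≤ t → |g s - g t| ≤ R * |s - t|) (y y' : E n) :
    ‖radial g y - radial g y'‖ ≤ 3 * R * dist y y' := by
  have hR : 0 ≤ R := by
    have h := (abs_nonneg _).trans (hl 1 0 zero_le_one le_rfl)
    simpa using h
  have hg : ∀ t, 0 ≤ t → |g t| ≤ R * t := fun t ht => by
    simpa [h0, abs_of_nonneg ht] using hl t 0 ht le_rfl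
  rcases eq_or_ne y 0 with rfl | hy
  · have h1 : radial g (0 : E n) = 0 := by simp [radial]
    rw [h1, zero_sub, norm_neg, dist_zero_left]
    refine (norm_radial_le y').trans ((hg _ (norm_nonneg _)).trans ?_)
    nlinarith [norm_nonneg y', mul_nonneg hR (norm_nonneg y')]
  rcases eq_or_ne y' 0 with rfl | hy'
  · have h1 : radial g (0 : E n) = 0 := by simp [radial]
    rw [h1, sub_zero, dist_zero_right]
    refine (norm_radial_le y).trans ((hg _ (norm_nonneg _)).trans ?_)
    nlinarith [mul_nonneg hR (norm_nonneg y)]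
  have hy0 : 0 < ‖y‖ := norm_pos_iff.2 hy
  have hy0' : 0 < ‖y'‖ := norm_pos_iff.2 hy'
  set D := dist y y' with hD
  have hnn : |‖y‖ - ‖y'‖| ≤ D := by rw [hD, dist_eq_norm]; exact abs_norm_sub_norm_le _ _
  have hunit : ‖‖y‖⁻¹ • y‖ = 1 := by
    rw [norm_smul, norm_inv, norm_norm, inv_mul_cancel₀ hy0.ne']
  have hdir : ‖y'‖ * ‖‖y‖⁻¹ • y - ‖y'‖⁻¹ • y'‖ ≤ 2 * D := by
    have h1 : ‖y'‖ * ‖‖y‖⁻¹ • y - ‖y'‖⁻¹ • y'‖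
        = ‖(‖y'‖ - ‖y‖) • (‖y‖⁻¹ • y) + (y - y')‖ := by
      rw [← norm_norm y', ← norm_smul, norm_norm, smul_sub, smul_inv_smul₀ hy0'.ne', sub_smul,
        smul_inv_smul₀ hy0.ne']
      congr 1
      abel
    rw [h1]
    refine (norm_add_le _ _).trans ?_
    rw [norm_smul, hunit, mul_one, Real.norm_eq_abs, abs_sub_comm, ← dist_eq_norm]
    linarith
  have hdec : radial g y - radial g y' = (g ‖y‖ - g ‖y'‖) • (‖y‖⁻¹ • y)
      + g ‖y'‖ • (‖y‖⁻¹ • y - ‖y'‖⁻¹ • y') := by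
    rw [radial, radial, sub_smul, smul_sub]
    abel
  rw [hdec]
  refine (norm_add_le _ _).trans ?_
  rw [norm_smul _ (‖y‖⁻¹ • y), hunit, mul_one, norm_smul, Real.norm_eq_abs, Real.norm_eq_abs]
  have h1 := hl _ _ hy0.le hy0'.le
  have h2 : |g ‖y'‖| * ‖‖y‖⁻¹ • y - ‖y'‖⁻¹ • y'‖ ≤ R * (2 * D) :=
    calc _ ≤ R * ‖y'‖ * ‖‖y‖⁻¹ • y - ‖y'‖⁻¹ • y'‖ := by gcongr; exact hg _ hy0'.le
      _ = R * (‖y'‖ * ‖‖y‖⁻¹ • y - ‖y'‖⁻¹ • y'‖) := by ring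
      _ ≤ _ := by gcongr
  have h3 : R * |‖y‖ - ‖y'‖| ≤ R * D := by gcongr
  linarith

theorem hasFDerivAt_norm_of_ne_zero {n : ℕ} {y : E n} (hy : y ≠ 0) :
    HasFDerivAt (fun y : E n => ‖y‖) (innerSL ℝ (‖y‖⁻¹ • y)) y := by
  have h := ((hasStrictFDerivAt_norm_sq y).hasFDerivAt).sqrt (by
    have := norm_pos_iff.2 hy
    positivity)
  simp only [Real.sqrt_sq (norm_nonneg _)] at h
  refine h.congr_fderiv ?_
  ext v
  have := norm_pos_iff.2 hy
  simp only [one_div, mul_inv, _root_.smul_apply, innerSL_apply_apply, smul_eq_mul,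
    inner_smul_left, map_inv₀, RCLike.conj_to_real]
  simp
  ring

/-- At the origin the hypothesis `ρ'(0) = 0` makes the rescaled kernel differentiable. -/
theorem gradient_rescale {n : ℕ} {f : ℝ → ℝ} (hf : IsProfile f)
    (h0 : derivWithin f (Ici 0) 0 = 0) {ε : ℝ} (hε : 0 < ε) (y : E n) :
    gradient (rescale n f ε) y
      = (ε ^ (n + 1))⁻¹ • radial (derivWithin f (Ici 0)) (ε⁻¹ • y) := by
  have hdiff : ∀ t, 0 ≤ t → HasDerivWithinAt f (derivWithin f (Ici 0) t) (Ici 0) t := fun t ht =>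
    ((hf.contDiffOn.differentiableOn one_ne_zero) t ht).hasDerivWithinAt
  apply HasGradientAt.gradient
  rw [hasGradientAt_iff_hasFDerivAt]
  rcases eq_or_ne y 0 with rfl | hy
  · have h := hdiff 0 le_rfl
    rw [h0, hasDerivWithinAt_iff_hasFDerivWithinAt] at h
    have hn : Tendsto (fun y : E n => ‖y‖ / ε) (𝓝 0) (𝓝[Ici 0] 0) := by
      refine tendsto_nhdsWithin_iff.2 ⟨?_, Eventually.of_forall fun y => by
        rw [mem_Ici]; positivity⟩
      exact (continuous_norm.div_const ε).tendsto' _ _ (by simp)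
    rw [hasFDerivAt_iff_isLittleO]
    have h2 : (fun y : E n => f (‖y‖ / ε) - f 0) =o[𝓝 0] fun y : E n => ‖y‖ / ε := by
      simpa [Function.comp_def] using h.isLittleO.comp_tendsto hn
    have h3 : (fun y : E n => ‖y‖ / ε) =O[𝓝 0] fun y : E n => y :=
      Asymptotics.IsBigO.of_bound ε⁻¹ (Eventually.of_forall fun y => by
        simp [abs_of_pos hε, div_eq_inv_mul])
    simpa [rescale, radial, mul_sub] using (h2.trans_isBigO h3).const_mul_left ((ε ^ n)⁻¹)
  · have hy0 : 0 < ‖y‖ := norm_pos_iff.2 hy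
    have ht : 0 < ‖y‖ / ε := by positivity
    have h1 : HasDerivAt f (derivWithin f (Ici 0) (‖y‖ / ε)) (‖y‖ / ε) :=
      (hdiff _ ht.le).hasDerivAt (Ici_mem_nhds ht)
    have h2 : HasFDerivAt (fun y : E n => ‖y‖ / ε) (ε⁻¹ • innerSL ℝ (‖y‖⁻¹ • y)) y := by
      simpa [div_eq_inv_mul] using (hasFDerivAt_norm_of_ne_zero hy).const_mul ε⁻¹
    have h3 := (h1.comp_hasFDerivAt y h2).const_mul ((ε ^ n)⁻¹)
    refine h3.congr_fderiv ?_
    have hnorm : ‖ε⁻¹ • y‖ = ‖y‖ / ε := by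
      rw [norm_smul, norm_inv, Real.norm_of_nonneg hε.le, inv_mul_eq_div]
    ext v
    simp only [radial, hnorm, _root_.smul_apply, innerSL_apply_apply, smul_eq_mul,
      InnerProductSpace.toDual_apply_apply, inner_smul_left, RCLike.conj_to_real]
    field_simp
    ring

theorem norm_gradient_rescale_le {n : ℕ} {ρ : ℝ → ℝ} (hρ : IsRho n ρ) {R : ℝ}
    (hb : ∀ t, 0 ≤ t → |derivWithin ρ (Ici 0) t| ≤ R) {ε : ℝ} (hε : 0 < ε) (y : E n) :
    ‖gradient (rescale n ρ ε) y‖ ≤ (ε ^ (n + 1))⁻¹ * R := by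
  rw [gradient_rescale hρ.toIsProfile hρ.deriv_zero hε, norm_smul, norm_inv,
    Real.norm_of_nonneg (by positivity)]
  gcongr
  exact (norm_radial_le _).trans (hb _ (norm_nonneg _))

theorem isKernel_gradient_rescale {d n : ℕ} {ρ : ℝ → ℝ} (hρ : IsRho n ρ) {R : ℝ} (hR : 0 ≤ R)
    (hb : ∀ t, 0 ≤ t → |derivWithin ρ (Ici 0) t| ≤ R)
    (hl : ∀ s t, 0 ≤ s → 0 ≤ t →
      |derivWithin ρ (Ici 0) s - derivWithin ρ (Ici 0) t| ≤ R * |s - t|)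
    {ε : ℝ} (hε : 0 < ε) (hε1 : ε ≤ 1) (i j k : Fin n) :
    IsKernel (d := d) (12 * R * (ε ^ (n + 2))⁻¹) ε
      (fun p => p.2.entry j k * (p.2.1 (gradient (rescale n ρ ε) p.1)) i) := by
  have hzero : ∀ t, 1 < t → derivWithin ρ (Ici 0) t = 0 := fun t ht => by
    have h : ρ =ᶠ[𝓝 t] fun _ => 0 := by
      filter_upwards [lt_mem_nhds ht] with s hs using hρ.eq_zero s hs.le
    rw [h.derivWithin_eq_of_nhds]
    simp
  have h := ((isKernel_apply (d := d) (n := n) (K := 3 * R * (ε ^ (n + 2))⁻¹) (ε := ε)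
    (G := gradient (rescale n ρ ε)) ?_ ?_ ?_ i).entry_mul j k)
  · convert h using 1
    ring
  · intro y
    calc _ ≤ (ε ^ (n + 1))⁻¹ * R := norm_gradient_rescale_le hρ hb hε y
      _ ≤ (ε ^ (n + 2))⁻¹ * R := by
          gcongr ?_⁻¹ * _
          exact pow_le_pow_of_le_one hε.le hε1 (Nat.le_succ _)
      _ ≤ 3 * R * (ε ^ (n + 2))⁻¹ := by
          have : 0 ≤ (ε ^ (n + 2))⁻¹ * R := by positivity
          linarith
  · intro y y'
    rw [gradient_rescale hρ.toIsProfile hρ.deriv_zero hε,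
      gradient_rescale hρ.toIsProfile hρ.deriv_zero hε, ← smul_sub, norm_smul, norm_inv,
      Real.norm_of_nonneg (by positivity)]
    have h1 := norm_radial_sub_radial_le hρ.deriv_zero hl (ε⁻¹ • y) (ε⁻¹ • y')
    rw [dist_smul₀, norm_inv, Real.norm_of_nonneg hε.le] at h1
    calc _ ≤ (ε ^ (n + 1))⁻¹ * (3 * R * (ε⁻¹ * dist y y')) := by gcongr
      _ = 3 * R * (ε ^ (n + 2))⁻¹ * dist y y' := by
        rw [pow_succ ε (n + 1), mul_inv]; ring
  · intro y hy
    have hnorm : ‖ε⁻¹ • y‖ = ‖y‖ / ε := by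
      rw [norm_smul, norm_inv, Real.norm_of_nonneg hε.le, inv_mul_eq_div]
    rw [gradient_rescale hρ.toIsProfile hρ.deriv_zero hε, radial, hnorm,
      hzero _ ((one_lt_div hε).2 hy), zero_smul, smul_zero]

/-! ### Norms and normalizing constants of the profiles -/

theorem abs_le_toReal_supNorm {f : ℝ → ℝ} (h : supNorm f ≠ ∞) {t : ℝ} (ht : 0 ≤ t) :
    |f t| ≤ (supNorm f).toReal := by
  have h1 : ‖f t‖ₑ ≤ supNorm f := le_iSup₂_of_le t ht le_rfl
  have h2 := ENNReal.toReal_mono h h1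
  rwa [toReal_enorm, Real.norm_eq_abs] at h2

theorem abs_sub_le_toReal_lipConst {f : ℝ → ℝ} (h : lipConst f ≠ ∞) {s t : ℝ} (hs : 0 ≤ s)
    (ht : 0 ≤ t) : |f s - f t| ≤ (lipConst f).toReal * |s - t| := by
  rcases eq_or_ne s t with rfl | hst
  · simp
  have h1 : edist (f s) (f t) / edist s t ≤ lipConst f :=
    le_iSup₂_of_le s hs (le_iSup₂_of_le t ht le_rfl)
  rw [ENNReal.div_le_iff (edist_pos.2 hst).ne' (edist_ne_top _ _)] at h1
  have h2 := ENNReal.toReal_mono (ENNReal.mul_ne_top h (edist_ne_top _ _)) h1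
  rwa [ENNReal.toReal_mul, edist_dist, edist_dist, ENNReal.toReal_ofReal dist_nonneg,
    ENNReal.toReal_ofReal dist_nonneg, Real.dist_eq, Real.dist_eq] at h2

theorem IsProfile.normW1_ne_top {f : ℝ → ℝ} (hf : IsProfile f) : normW1 f ≠ ∞ := by
  obtain ⟨K, hK, hb, hl⟩ := hf.exists_bound
  have h1 : supNorm f ≤ ENNReal.ofReal K := iSup₂_le fun t ht => by
    rw [Real.enorm_eq_ofReal_abs]
    exact ENNReal.ofReal_le_ofReal (hb t ht)
  have h2 : lipConst f ≤ ENNReal.ofReal K := iSup₂_le fun s hs => iSup₂_le fun t ht => by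
    refine ENNReal.div_le_of_le_mul ?_
    rw [edist_dist, edist_dist, ← ENNReal.ofReal_mul hK.le]
    exact ENNReal.ofReal_le_ofReal (hl s t hs ht)
  exact (ENNReal.add_lt_top.2
    ⟨h1.trans_lt ENNReal.ofReal_lt_top, h2.trans_lt ENNReal.ofReal_lt_top⟩).ne

theorem abs_derivWithin_le_toReal_normW2 {ρ : ℝ → ℝ} (h : normW2 ρ ≠ ∞) {t : ℝ} (ht : 0 ≤ t) :
    |derivWithin ρ (Ici 0) t| ≤ (normW2 ρ).toReal := by
  have h1 : supNorm (derivWithin ρ (Ici 0)) ≤ normW2 ρ :=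
    le_self_add.trans (le_add_self (a := normW1 (derivWithin ρ (Ici 0))))
  exact (abs_le_toReal_supNorm (ne_top_of_le_ne_top h h1) ht).trans (ENNReal.toReal_mono h h1)

theorem abs_derivWithin_sub_le_toReal_normW2 {ρ : ℝ → ℝ} (h : normW2 ρ ≠ ∞) {s t : ℝ}
    (hs : 0 ≤ s) (ht : 0 ≤ t) :
    |derivWithin ρ (Ici 0) s - derivWithin ρ (Ici 0) t| ≤ (normW2 ρ).toReal * |s - t| := by
  have h1 : lipConst (derivWithin ρ (Ici 0)) ≤ normW2 ρ :=
    le_add_self.trans (le_add_self (a := normW1 (derivWithin ρ (Ici 0))))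
  refine (abs_sub_le_toReal_lipConst (ne_top_of_le_ne_top h h1) hs ht).trans ?_
  gcongr

/-- A normalized decreasing profile is at least `1 / ω_n` at the origin. -/
theorem IsRho.ofReal_inv_le_normW1 {n : ℕ} {ρ : ℝ → ℝ} (hρ : IsRho n ρ) :
    ENNReal.ofReal (volume.real (Metric.closedBall (0 : E n) 1))⁻¹ ≤ normW1 ρ := by
  set v := volume.real (Metric.closedBall (0 : E n) 1) with hv
  have hv0 : 0 < v := ENNReal.toReal_pos (Metric.measure_closedBall_pos volume _ one_pos).ne'
    measure_closedBall_lt_top.ne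
  have h1 : (1 : ℝ) ≤ ρ 0 * v := by
    rw [← hρ.integral_eq_one, ← setIntegral_eq_integral_of_forall_compl_eq_zero
      (s := Metric.closedBall (0 : E n) 1)]
    · refine (le_abs_self _).trans ?_
      refine norm_setIntegral_le_of_norm_le_const (f := fun x : E n => ρ ‖x‖)
        measure_closedBall_lt_top fun x _ => ?_
      rw [Real.norm_of_nonneg (hρ.nonneg _ (norm_nonneg x))]
      exact hρ.antitoneOn self_mem_Ici (norm_nonneg x) (norm_nonneg x)
    · intro x hx
      rw [mem_closedBall_zero_iff, not_le] at hx
      exact hρ.eq_zero _ hx.le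
  have h2 : v⁻¹ ≤ ρ 0 := by rwa [inv_le_iff_one_le_mul₀ hv0]
  refine (ENNReal.ofReal_le_ofReal (h2.trans (le_abs_self _))).trans ?_
  rw [← Real.enorm_eq_ofReal_abs]
  exact (le_iSup₂_of_le (f := fun t _ => ‖ρ t‖ₑ) 0 self_mem_Ici le_rfl).trans le_self_add

/-- Since `r ^ (n - 1) ≤ r ^ (d - 1)` on `[0, 1]`, polar coordinates in `ℝⁿ` bound `C_ρ` from
below independently of `ρ`. -/
theorem IsRho.le_kernelConst {n d : ℕ} (hd : 1 ≤ d) (hdn : d ≤ n) {ρ : ℝ → ℝ} (hρ : IsRho n ρ) :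
    d * omega d / (n * omega n) ≤ kernelConst d ρ := by
  have : Nontrivial (E n) := by
    have : Nonempty (Fin n) := ⟨⟨0, hd.trans hdn⟩⟩
    infer_instance
  have hn : (0 : ℝ) < n := by exact_mod_cast (hd.trans hdn)
  have hcont : ContinuousOn ρ (Icc 0 1) :=
    hρ.contDiffOn.continuousOn.mono Icc_subset_Ici_self
  have h1 := integral_fun_norm_addHaar (volume : Measure (E n)) ρ
  rw [hρ.integral_eq_one, finrank_euclideanSpace_fin] at h1
  have h2 : ∫ y in Ioi (0 : ℝ), y ^ (n - 1) • ρ y = ∫ y in (0 : ℝ)..1, ρ y * y ^ (n - 1) := by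
    rw [intervalIntegral.integral_of_le zero_le_one,
      ← setIntegral_eq_of_subset_of_forall_sdiff_eq_zero measurableSet_Ioi
        (Ioc_subset_Ioi_self (a := (1 : ℝ)) (b := 0))]
    · simp only [smul_eq_mul, mul_comm]
    · rintro y ⟨hy, hy'⟩
      have : 1 ≤ y := by
        by_contra h
        exact hy' ⟨hy, (not_le.1 h).le⟩
      rw [hρ.eq_zero y this, zero_mul]
  have hint : ∀ m : ℕ, IntervalIntegrable (fun y => ρ y * y ^ m) volume 0 1 := fun m =>
    (ContinuousOn.mul (by rwa [uIcc_of_le zero_le_one]) (by fun_prop)).intervalIntegrable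
  have h3 : ∫ y in (0 : ℝ)..1, ρ y * y ^ (n - 1) ≤ ∫ y in (0 : ℝ)..1, ρ y * y ^ (d - 1) := by
    refine intervalIntegral.integral_mono_on zero_le_one (hint _) (hint _) fun y hy => ?_
    exact mul_le_mul_of_nonneg_left (pow_le_pow_of_le_one hy.1 hy.2 (by omega))
      (hρ.nonneg y hy.1)
  rw [h2, nsmul_eq_mul, smul_eq_mul, measureReal_def] at h1
  change (1 : ℝ) = n * (omega n * _) at h1
  have hω := omega_pos n
  have hω' := omega_pos d
  rw [kernelConst, div_le_iff₀ (by positivity)]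
  have h4 : 1 ≤ n * omega n * ∫ y in (0 : ℝ)..1, ρ y * y ^ (d - 1) := by
    calc (1 : ℝ) = n * omega n * ∫ y in (0 : ℝ)..1, ρ y * y ^ (n - 1) := by rw [mul_assoc]; exact h1
      _ ≤ _ := by gcongr
  have h5 : 0 ≤ d * omega d := by positivity
  nlinarith

/-! ### Stability of quotients and of the linear system -/

theorem abs_div_sub_div_le {N N' D D' a b c : ℝ} (hD : 0 < D) (hD' : D / 2 ≤ D')
    (hN : |N' - N| ≤ a * D) (hDD : |D' - D| ≤ b * D) (hND : |N| ≤ c * D) :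
    |N' / D' - N / D| ≤ 2 * (a + c * b) := by
  have hD0 : 0 < D' := by linarith
  have hb : 0 ≤ b * D := (abs_nonneg _).trans hDD
  have hq : |N / D| ≤ c := by rwa [abs_div, abs_of_pos hD, div_le_iff₀ hD]
  have h1 : N' / D' - N / D = ((N' - N) - N / D * (D' - D)) / D' := by
    field_simp
    ring
  rw [h1, abs_div, abs_of_pos hD0, div_le_iff₀ hD0]
  have h2 : |N / D * (D' - D)| ≤ c * (b * D) := by
    rw [abs_mul]
    exact mul_le_mul hq hDD (abs_nonneg _) ((abs_nonneg _).trans hq)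
  have h3 := (abs_sub (N' - N) (N / D * (D' - D))).trans (add_le_add hN h2)
  have h4 : 0 ≤ a + c * b := by
    have h5 : 0 ≤ (a + c * b) * D := by
      refine ((abs_nonneg _).trans h3).trans_eq ?_
      ring
    exact nonneg_of_mul_nonneg_left h5 hD
  nlinarith

theorem isUnit_det_one_add {n : ℕ} {c : Matrix (Fin n) (Fin n) ℝ}
    (hc : ∀ v : Fin n → ℝ, 0 ≤ v ⬝ᵥ c *ᵥ v) : IsUnit (1 + c).det := by
  rw [isUnit_iff_ne_zero]
  intro h
  obtain ⟨v, hv, h0⟩ := Matrix.exists_mulVec_eq_zero_iff.2 h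
  have h1 : v ⬝ᵥ v + v ⬝ᵥ c *ᵥ v = 0 := by
    rw [← dotProduct_add, ← Matrix.one_mulVec v, Matrix.mulVec_mulVec, mul_one,
      ← Matrix.add_mulVec, Matrix.one_mulVec, h0, dotProduct_zero]
  have h2 : 0 ≤ v ⬝ᵥ v := Finset.sum_nonneg fun i _ => mul_self_nonneg _
  exact hv (dotProduct_self_eq_zero.1 (by linarith [hc v]))

/-- If the quadratic form of `c` is non-negative, then `(I + c)⁻¹` does not increase the Euclidean
norm. -/
theorem abs_le_of_add_mulVec_eq {n : ℕ} {c : Matrix (Fin n) (Fin n) ℝ}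
    (hc : ∀ v : Fin n → ℝ, 0 ≤ v ⬝ᵥ c *ᵥ v) {u v : Fin n → ℝ} (huv : (1 + c) *ᵥ u = v) {B : ℝ}
    (hv : ∀ i, |v i| ≤ B) (i : Fin n) : |u i| ≤ n * B := by
  have hB : 0 ≤ B := (abs_nonneg _).trans (hv i)
  have h1 : u ⬝ᵥ u + u ⬝ᵥ c *ᵥ u = u ⬝ᵥ v := by
    rw [← huv, Matrix.add_mulVec, Matrix.one_mulVec, dotProduct_add]
  have h2 : 2 * (u ⬝ᵥ v) ≤ u ⬝ᵥ u + v ⬝ᵥ v := by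
    simp only [dotProduct, Finset.mul_sum, ← Finset.sum_add_distrib]
    exact Finset.sum_le_sum fun i _ => by nlinarith [sq_nonneg (u i - v i)]
  have h3 : v ⬝ᵥ v ≤ n * (B * B) := by
    have h : ∀ i ∈ Finset.univ, v i * v i ≤ B * B := fun i _ => by
      rw [← abs_mul_abs_self]
      exact mul_self_le_mul_self (abs_nonneg _) (hv i)
    simpa [dotProduct] using Finset.sum_le_sum h
  have h4 : u i * u i ≤ u ⬝ᵥ u :=
    Finset.single_le_sum (f := fun i => u i * u i) (fun i _ => mul_self_nonneg _)
      (Finset.mem_univ i)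
  have hn : (1 : ℝ) ≤ n := by exact_mod_cast (Fin.pos i)
  have h5 : u i * u i ≤ (n * B) * (n * B) := by
    have h6 : (n : ℝ) * (B * B) ≤ n * (n * (B * B)) :=
      mul_le_mul_of_nonneg_left (le_mul_of_one_le_left (mul_self_nonneg B) hn) (by positivity)
    nlinarith [hc u]
  exact abs_le_of_sq_le_sq (by nlinarith) (by positivity)

theorem abs_solveSystem_sub_le {n : ℕ} {c c' : Matrix (Fin n) (Fin n) ℝ}
    (hc : ∀ v : Fin n → ℝ, 0 ≤ v ⬝ᵥ c *ᵥ v) (hc' : ∀ v : Fin n → ℝ, 0 ≤ v ⬝ᵥ c' *ᵥ v)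
    (hc1 : ∀ j k, |c' j k| ≤ 1) {e f B : ℝ} (hcc : ∀ j k, |c' j k - c j k| ≤ e)
    {b b' : Fin n → Fin n → Fin n → ℝ} (hbb : ∀ i j k, |b' i j k - b i j k| ≤ f)
    (hb : ∀ i j k, |b i j k| ≤ B) (i j k : Fin n) :
    |solveSystem c' b' i j k - solveSystem c b i j k|
      ≤ (1 + n ^ 2) * f + (n ^ 4 + n ^ 2) * (e * B) := by
  have he : 0 ≤ e := (abs_nonneg _).trans (hcc j k)
  have hB : 0 ≤ B := (abs_nonneg _).trans (hb i j k)
  set H : Fin n → ℝ := fun m => ∑ q, b q m q with hH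
  set H' : Fin n → ℝ := fun m => ∑ q, b' q m q with hH'
  set u := (1 + c)⁻¹ *ᵥ H with hu
  set u' := (1 + c')⁻¹ *ᵥ H' with hu'
  have h1 : (1 + c) *ᵥ u = H := by
    rw [hu, Matrix.mulVec_mulVec, Matrix.mul_nonsing_inv _ (isUnit_det_one_add hc),
      Matrix.one_mulVec]
  have h1' : (1 + c') *ᵥ u' = H' := by
    rw [hu', Matrix.mulVec_mulVec, Matrix.mul_nonsing_inv _ (isUnit_det_one_add hc'),
      Matrix.one_mulVec]
  have hHB : ∀ m, |H m| ≤ n * B := fun m => by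
    refine (Finset.abs_sum_le_sum_abs _ _).trans ?_
    simpa using Finset.sum_le_sum fun q (_ : q ∈ Finset.univ) => hb q m q
  have hHf : ∀ m, |H' m - H m| ≤ n * f := fun m => by
    rw [hH, hH', ← Finset.sum_sub_distrib]
    refine (Finset.abs_sum_le_sum_abs _ _).trans ?_
    simpa using Finset.sum_le_sum fun q (_ : q ∈ Finset.univ) => hbb q m q
  have huB : ∀ m, |u m| ≤ n * (n * B) := abs_le_of_add_mulVec_eq hc h1 hHB
  -- the resolvent identity `u' - u = (I + c')⁻¹ (H' - H + (c - c') u)`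
  have h2 : (1 + c') *ᵥ (u' - u) = (H' - H) + (c - c') *ᵥ u := by
    rw [Matrix.mulVec_sub, h1', ← h1, Matrix.add_mulVec, Matrix.add_mulVec, Matrix.sub_mulVec]
    abel
  have h3 : ∀ m, |((H' - H) + (c - c') *ᵥ u) m| ≤ n * f + n * (e * (n * (n * B))) := fun m => by
    refine (abs_add_le _ _).trans (add_le_add (hHf m) ?_)
    change |∑ q, (c - c') m q * u q| ≤ _
    refine (Finset.abs_sum_le_sum_abs _ _).trans ?_
    have : ∀ q ∈ Finset.univ, |(c - c') m q * u q| ≤ e * (n * (n * B)) := fun q _ => by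
      rw [abs_mul, Matrix.sub_apply, abs_sub_comm]
      exact mul_le_mul (hcc m q) (huB q) (abs_nonneg _) he
    simpa using Finset.sum_le_sum this
  have h4 : |u' i - u i| ≤ n * (n * f + n * (e * (n * (n * B)))) :=
    abs_le_of_add_mulVec_eq hc' h2 h3 i
  have h5 : solveSystem c' b' i j k - solveSystem c b i j k
      = (b' i j k - b i j k) - (c' j k * (u' i - u i) + (c' j k - c j k) * u i) := by
    change (b' i j k - c' j k * u' i) - (b i j k - c j k * u i) = _
    ring
  rw [h5]
  refine (abs_sub _ _).trans ((add_le_add (hbb i j k) (abs_add_le _ _)).trans ?_)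
  rw [abs_mul, abs_mul]
  have h6 : |c' j k| * |u' i - u i| ≤ 1 * (n * (n * f + n * (e * (n * (n * B))))) :=
    mul_le_mul (hc1 j k) h4 (abs_nonneg _) zero_le_one
  have h7 : |c' j k - c j k| * |u i| ≤ e * (n * (n * B)) :=
    mul_le_mul (hcc j k) (huB i) (abs_nonneg _) he
  nlinarith

/-! ### Regularized mass, variation and tangent matrix -/

theorem continuous_rescale {n : ℕ} {f : ℝ → ℝ} (hf : IsProfile f) {ε : ℝ} (hε : 0 < ε) :
    Continuous (rescale n f ε) :=
  continuous_const.mul (hf.contDiffOn.continuousOn.comp_continuous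
    (continuous_norm.div_const ε) fun y => by
      rw [mem_Ici]
      positivity)

theorem rescale_nonneg {n : ℕ} {f : ℝ → ℝ} (hf : IsProfile f) {ε : ℝ} (hε : 0 < ε) (y : E n) :
    0 ≤ rescale n f ε y :=
  mul_nonneg (by positivity) (hf.nonneg _ (by positivity))

theorem Varifold.massConv_eq {d n : ℕ} {Ω : Set (E n)} (V : Varifold d n Ω) {f : ℝ → ℝ}
    (hf : IsProfile f) {ε : ℝ} (hε : 0 < ε) (z : E n) :
    V.massConv f ε z = ∫ p, recentre (fun p => rescale n f ε p.1) z p ∂V.measure := by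
  have hc : Continuous fun y => rescale n f ε (y - z) :=
    (continuous_rescale hf hε).comp (continuous_id.sub continuous_const)
  rw [Varifold.massConv, Varifold.mass, integral_map measurable_fst.aemeasurable
    hc.aestronglyMeasurable]
  rfl

theorem Varifold.massConv_nonneg {d n : ℕ} {Ω : Set (E n)} (V : Varifold d n Ω) {f : ℝ → ℝ}
    (hf : IsProfile f) {ε : ℝ} (hε : 0 < ε) (z : E n) : 0 ≤ V.massConv f ε z :=
  integral_nonneg fun _ => rescale_nonneg hf hε _

theorem Varifold.integrable_rescale {d n : ℕ} {Ω : Set (E n)} (V : Varifold d n Ω) {f : ℝ → ℝ}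
    (hf : IsProfile f) {ε : ℝ} (hε : 0 < ε) (hε1 : ε ≤ 1) {z : E n}
    (hz : Metric.closedBall z ε ⊆ Ω) :
    Integrable (fun p => rescale n f ε (p.1 - z)) V.measure := by
  obtain ⟨K, hK, hb, hl⟩ := hf.exists_bound
  exact (isKernel_rescale hf hK.le hb hl hε hε1).integrable (by positivity) V hz

theorem Varifold.integrable_entry_mul_rescale {d n : ℕ} {Ω : Set (E n)} (V : Varifold d n Ω)
    {f : ℝ → ℝ} (hf : IsProfile f) {ε : ℝ} (hε : 0 < ε) (hε1 : ε ≤ 1) {z : E n}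
    (hz : Metric.closedBall z ε ⊆ Ω) (j k : Fin n) :
    Integrable (fun p => p.2.entry j k * rescale n f ε (p.1 - z)) V.measure := by
  obtain ⟨K, hK, hb, hl⟩ := hf.exists_bound
  exact ((isKernel_rescale hf hK.le hb hl hε hε1).entry_mul j k).integrable (by positivity) V hz

theorem Varifold.abs_integral_entry_mul_le {d n : ℕ} {Ω : Set (E n)} (V : Varifold d n Ω)
    {f : ℝ → ℝ} (hf : IsProfile f) {ε : ℝ} (hε : 0 < ε) (hε1 : ε ≤ 1) {z : E n}
    (hz : Metric.closedBall z ε ⊆ Ω) (j k : Fin n) :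
    |∫ p, p.2.entry j k * rescale n f ε (p.1 - z) ∂V.measure| ≤ V.massConv f ε z := by
  rw [V.massConv_eq hf hε, ← Real.norm_eq_abs]
  refine norm_integral_le_of_norm_le (V.integrable_rescale hf hε hε1 hz)
    (Eventually.of_forall fun p => ?_)
  have h0 := rescale_nonneg hf hε (p.1 - z)
  rw [norm_mul, Real.norm_of_nonneg h0, Real.norm_eq_abs]
  exact mul_le_of_le_one_left h0 (p.2.abs_entry_le_one j k)

theorem Varifold.abs_cApprox_le_one {d n : ℕ} {Ω : Set (E n)} (V : Varifold d n Ω)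
    {η : ℝ → ℝ} (hη : IsProfile η) {ε : ℝ} (hε : 0 < ε) (hε1 : ε ≤ 1) {z : E n}
    (hz : Metric.closedBall z ε ⊆ Ω) (j k : Fin n) : |V.cApprox η ε z j k| ≤ 1 := by
  have h0 := V.massConv_nonneg hη hε z
  rw [Varifold.cApprox, abs_div, abs_of_nonneg h0]
  exact div_le_one_of_le₀ (V.abs_integral_entry_mul_le hη hε hε1 hz j k) h0

/-- The matrix `c^{V,ε}`, an average of orthogonal projections, has a non-negative quadratic
form. -/
theorem Varifold.dotProduct_cApprox_nonneg {d n : ℕ} {Ω : Set (E n)} (V : Varifold d n Ω)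
    {η : ℝ → ℝ} (hη : IsProfile η) {ε : ℝ} (hε : 0 < ε) (hε1 : ε ≤ 1) {z : E n}
    (hz : Metric.closedBall z ε ⊆ Ω) (v : Fin n → ℝ) : 0 ≤ v ⬝ᵥ V.cApprox η ε z *ᵥ v := by
  have hint := fun j k => V.integrable_entry_mul_rescale hη hε hε1 hz j k
  have h1 : v ⬝ᵥ V.cApprox η ε z *ᵥ v
      = (∫ p, (∑ j, v j * ∑ k, p.2.entry j k * v k) * rescale n η ε (p.1 - z) ∂V.measure)
        / V.massConv η ε z := by
    have h2 : ∀ p : E n × Grass d n,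
        (∑ j, v j * ∑ k, p.2.entry j k * v k) * rescale n η ε (p.1 - z)
          = ∑ j, ∑ k, v j * v k * (p.2.entry j k * rescale n η ε (p.1 - z)) := fun p => by
      simp only [Finset.mul_sum, Finset.sum_mul]
      exact Finset.sum_congr rfl fun j _ => Finset.sum_congr rfl fun k _ => by ring
    simp only [h2]
    rw [integral_finsetSum _ fun j _ => integrable_finsetSum _ fun k _ => (hint j k).const_mul _]
    simp only [dotProduct, Matrix.mulVec, Finset.mul_sum, Finset.sum_div]
    refine Finset.sum_congr rfl fun j _ => ?_
    rw [integral_finsetSum _ fun k _ => (hint j k).const_mul _, Finset.sum_div]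
    refine Finset.sum_congr rfl fun k _ => ?_
    rw [integral_const_mul, Varifold.cApprox]
    ring
  rw [h1]
  exact div_nonneg (integral_nonneg fun p => mul_nonneg (p.2.sum_mul_sum_entry_nonneg v)
    (rescale_nonneg hη hε _)) (V.massConv_nonneg hη hε z)

/-! ### Estimates at a fixed scale -/

/-- The scale `ε` is adapted to the points `x`, `z` and to the varifolds `V`, `W`: the balls
involved lie in `Ω`, and the flat distance in a ball about `x` is controlled by `δ` times the mass
of `V` in a slightly larger one. -/
structure IsGoodScale {d n : ℕ} {Ω : Set (E n)} (V W : Varifold d n Ω) (x z : E n) (ε δ : ℝ) :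
    Prop where
  pos : 0 < ε
  le_one : ε ≤ 1
  nonneg : 0 ≤ δ
  dist_le : dist x z ≤ ε
  subset : Metric.closedBall x (3 * ε) ⊆ Ω
  flatDist_le : flatDist (Metric.ball x (5 / 2 * ε)) V W
    ≤ ENNReal.ofReal δ * V.mass (Metric.ball x (3 * ε))

/-- The mass of the ball of radius `3ε` about `x` is controlled by the mass regularized with the
profile `f`, which is positive. -/
structure IsDominated {d n : ℕ} {Ω : Set (E n)} (V : Varifold d n Ω) (f : ℝ → ℝ) (x : E n)
    (ε Λ : ℝ) : Prop where
  pos : 0 < V.massConv f ε x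
  le : V.mass.real (Metric.ball x (3 * ε)) ≤ Λ * (ε ^ n * V.massConv f ε x)

theorem IsGoodScale.closedBall_subset {d n : ℕ} {Ω : Set (E n)} {V W : Varifold d n Ω}
    {x z : E n} {ε δ : ℝ} (h : IsGoodScale V W x z ε δ) : Metric.closedBall z ε ⊆ Ω := by
  refine (Metric.closedBall_subset_closedBall' ?_).trans h.subset
  rw [dist_comm]
  linarith [h.dist_le, h.pos]

theorem IsGoodScale.closedBall_subset' {d n : ℕ} {Ω : Set (E n)} {V W : Varifold d n Ω}
    {x z : E n} {ε δ : ℝ} (h : IsGoodScale V W x z ε δ) : Metric.closedBall x ε ⊆ Ω :=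
  (Metric.closedBall_subset_closedBall (by linarith [h.pos])).trans h.subset

theorem IsGoodScale.abs_integral_sub_le {d n : ℕ} {Ω : Set (E n)} {V W : Varifold d n Ω}
    {x z : E n} {ε δ : ℝ} (h : IsGoodScale V W x z ε δ) {f : ℝ → ℝ} {Λ : ℝ}
    (hD : IsDominated V f x ε Λ) {φ : E n × Grass d n → ℝ} {k : ℝ} (hk : 0 ≤ k)
    (hφ : IsKernel (k * (ε ^ (n + 1))⁻¹) ε φ) :
    |∫ p, recentre φ z p ∂W.measure - ∫ p, recentre φ x p ∂V.measure|
      ≤ k * Λ * ((δ + dist x z) / ε) * V.massConv f ε x := by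
  have hε := h.pos
  have hδ := h.nonneg
  refine (hφ.abs_integral_sub_le (by positivity) h.pos h.nonneg h.dist_le h.subset
    h.flatDist_le).trans ?_
  calc _ ≤ k * (ε ^ (n + 1))⁻¹ * (δ + dist x z) * (Λ * (ε ^ n * V.massConv f ε x)) := by
        gcongr
        exact hD.le
    _ = _ := by
        field_simp
        ring

theorem IsGoodScale.abs_massConv_sub_le {d n : ℕ} {Ω : Set (E n)} {V W : Varifold d n Ω}
    {x z : E n} {ε δ : ℝ} (h : IsGoodScale V W x z ε δ) {f : ℝ → ℝ} (hf : IsProfile f) {Λ : ℝ}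
    (hD : IsDominated V f x ε Λ) {K : ℝ} (hK : 0 ≤ K) (hb : ∀ t, 0 ≤ t → |f t| ≤ K)
    (hl : ∀ s t, 0 ≤ s → 0 ≤ t → |f s - f t| ≤ K * |s - t|) :
    |W.massConv f ε z - V.massConv f ε x|
      ≤ K * Λ * ((δ + dist x z) / ε) * V.massConv f ε x := by
  have h1 := h.abs_integral_sub_le hD hK (isKernel_rescale hf hK hb hl h.pos h.le_one)
  rwa [← W.massConv_eq hf h.pos, ← V.massConv_eq hf h.pos] at h1

theorem half_le_of_abs_sub_le {D D' b : ℝ} (hD : 0 < D) (h : |D' - D| ≤ b * D) (hb : b ≤ 1 / 2) :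
    D / 2 ≤ D' := by
  have := neg_abs_le (D' - D)
  nlinarith

theorem IsGoodScale.abs_cApprox_sub_le {d n : ℕ} {Ω : Set (E n)} {V W : Varifold d n Ω}
    {x z : E n} {ε δ : ℝ} (h : IsGoodScale V W x z ε δ) {η : ℝ → ℝ} (hη : IsProfile η) {Λ : ℝ}
    (hD : IsDominated V η x ε Λ) {K : ℝ} (hK : 0 ≤ K) (hb : ∀ t, 0 ≤ t → |η t| ≤ K)
    (hl : ∀ s t, 0 ≤ s → 0 ≤ t → |η s - η t| ≤ K * |s - t|)
    (hsmall : K * Λ * ((δ + dist x z) / ε) ≤ 1 / 2) (j k : Fin n) :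
    |W.cApprox η ε z j k - V.cApprox η ε x j k| ≤ 6 * K * Λ * ((δ + dist x z) / ε) := by
  have hDD := h.abs_massConv_sub_le hη hD hK hb hl
  have hker := (isKernel_rescale (d := d) (n := n) hη hK hb hl h.pos h.le_one).entry_mul j k
  rw [← mul_assoc] at hker
  have hN := h.abs_integral_sub_le hD (by positivity) hker
  have hV := V.abs_integral_entry_mul_le hη h.pos h.le_one h.closedBall_subset' j k
  rw [← one_mul (V.massConv η ε x)] at hV
  refine (abs_div_sub_div_le hD.pos (half_le_of_abs_sub_le hD.pos hDD hsmall) hN hDD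
    hV).trans_eq ?_
  ring

theorem Varifold.abs_variationConv_le {d n : ℕ} {Ω : Set (E n)} (V : Varifold d n Ω)
    {ρ : ℝ → ℝ} (hρ : IsRho n ρ) {R : ℝ} (hR : 0 ≤ R)
    (hb : ∀ t, 0 ≤ t → |derivWithin ρ (Ici 0) t| ≤ R)
    (hl : ∀ s t, 0 ≤ s → 0 ≤ t →
      |derivWithin ρ (Ici 0) s - derivWithin ρ (Ici 0) t| ≤ R * |s - t|)
    {ε : ℝ} (hε : 0 < ε) (hε1 : ε ≤ 1) {x : E n} (hx : Metric.closedBall x (3 * ε) ⊆ Ω)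
    (i j k : Fin n) :
    |V.variationConv ρ ε x i j k|
      ≤ (ε ^ (n + 1))⁻¹ * R * V.mass.real (Metric.ball x (3 * ε)) := by
  refine V.abs_integral_le (fun p => ?_)
    ((measure_mono Metric.ball_subset_closedBall).trans_lt (V.mass_closedBall_lt_top hx))
    fun p hp => ?_
  · have h1 := ((PiLp.norm_apply_le (p.2.1 (gradient (rescale n ρ ε) (p.1 - x))) i).trans
      (p.2.norm_apply_le _)).trans (norm_gradient_rescale_le hρ hb hε (p.1 - x))
    rw [abs_mul]
    exact (mul_le_of_le_one_left (abs_nonneg _) (p.2.abs_entry_le_one j k)).trans h1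
  · exact (isKernel_gradient_rescale hρ hR hb hl hε hε1 i j k).recentre_eq_zero (by linarith)

theorem IsGoodScale.abs_betaApprox_le {d n : ℕ} {Ω : Set (E n)} {V W : Varifold d n Ω}
    {x z : E n} {ε δ : ℝ} (h : IsGoodScale V W x z ε δ) {ξ : ℝ → ℝ}
    {Λ : ℝ} (hD : IsDominated V ξ x ε Λ)
    {ρ : ℝ → ℝ} (hρ : IsRho n ρ) {R : ℝ} (hR : 0 ≤ R)
    (hb : ∀ t, 0 ≤ t → |derivWithin ρ (Ici 0) t| ≤ R)
    (hl : ∀ s t, 0 ≤ s → 0 ≤ t →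
      |derivWithin ρ (Ici 0) s - derivWithin ρ (Ici 0) t| ≤ R * |s - t|)
    {Γ : ℝ} (hΓ : |kernelConst d ξ / kernelConst d ρ| ≤ Γ) (i j k : Fin n) :
    |V.variationConv ρ ε x i j k| ≤ R * Λ / ε * V.massConv ξ ε x ∧
      |V.betaApprox ρ ξ ε x i j k| ≤ Γ * Λ * R / ε := by
  have hε := h.pos
  have h1 : |V.variationConv ρ ε x i j k| ≤ R * Λ / ε * V.massConv ξ ε x := by
    refine (V.abs_variationConv_le hρ hR hb hl h.pos h.le_one h.subset i j k).trans ?_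
    calc _ ≤ (ε ^ (n + 1))⁻¹ * R * (Λ * (ε ^ n * V.massConv ξ ε x)) := by
          gcongr
          exact hD.le
      _ = _ := by
          field_simp
          ring
  refine ⟨h1, ?_⟩
  rw [Varifold.betaApprox, abs_mul, abs_neg, abs_div (V.variationConv ρ ε x i j k),
    abs_of_pos hD.pos]
  calc _ ≤ Γ * (R * Λ / ε) :=
        mul_le_mul hΓ ((div_le_iff₀ hD.pos).2 h1) (div_nonneg (abs_nonneg _) hD.pos.le)
          ((abs_nonneg _).trans hΓ)
    _ = _ := by ring

theorem IsGoodScale.abs_betaApprox_sub_le {d n : ℕ} {Ω : Set (E n)} {V W : Varifold d n Ω}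
    {x z : E n} {ε δ : ℝ} (h : IsGoodScale V W x z ε δ) {ξ : ℝ → ℝ} (hξ : IsProfile ξ)
    {Λ : ℝ} (hD : IsDominated V ξ x ε Λ) {K : ℝ} (hK : 0 ≤ K) (hbξ : ∀ t, 0 ≤ t → |ξ t| ≤ K)
    (hlξ : ∀ s t, 0 ≤ s → 0 ≤ t → |ξ s - ξ t| ≤ K * |s - t|)
    (hsmall : K * Λ * ((δ + dist x z) / ε) ≤ 1 / 2)
    {ρ : ℝ → ℝ} (hρ : IsRho n ρ) {R : ℝ} (hR : 0 ≤ R)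
    (hb : ∀ t, 0 ≤ t → |derivWithin ρ (Ici 0) t| ≤ R)
    (hl : ∀ s t, 0 ≤ s → 0 ≤ t →
      |derivWithin ρ (Ici 0) s - derivWithin ρ (Ici 0) t| ≤ R * |s - t|)
    {Γ : ℝ} (hΓ : |kernelConst d ξ / kernelConst d ρ| ≤ Γ) (i j k : Fin n) :
    |W.betaApprox ρ ξ ε z i j k - V.betaApprox ρ ξ ε x i j k|
      ≤ 2 * Γ * Λ * (12 + K * Λ) * R * ((δ + dist x z) / ε ^ 2) := by
  have hε := h.pos
  have hDD := h.abs_massConv_sub_le hξ hD hK hbξ hlξ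
  have hker := isKernel_gradient_rescale (d := d) hρ hR hb hl h.pos h.le_one i j k
  have hK' : 12 * R * (ε ^ (n + 2))⁻¹ = 12 * R / ε * (ε ^ (n + 1))⁻¹ := by
    rw [pow_succ ε (n + 1), mul_inv]; ring
  rw [hK'] at hker
  have hN := h.abs_integral_sub_le hD (by positivity) hker
  have hV := (h.abs_betaApprox_le hD hρ hR hb hl hΓ i j k).1
  have hq := abs_div_sub_div_le hD.pos (half_le_of_abs_sub_le hD.pos hDD hsmall) hN hDD hV
  have hq' : |W.variationConv ρ ε z i j k / W.massConv ξ ε z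
      - V.variationConv ρ ε x i j k / V.massConv ξ ε x|
      ≤ 2 * Λ * (12 + K * Λ) * R * ((δ + dist x z) / ε ^ 2) := by
    refine hq.trans_eq ?_
    field_simp
  rw [Varifold.betaApprox, Varifold.betaApprox, ← mul_sub, abs_mul, abs_neg]
  calc _ ≤ Γ * (2 * Λ * (12 + K * Λ) * R * ((δ + dist x z) / ε ^ 2)) :=
        mul_le_mul hΓ hq' (abs_nonneg _) ((abs_nonneg _).trans hΓ)
    _ = _ := by ring

/-! ### Good scales near almost every point -/

theorem Varifold.IsRectifiable.exists_weighted {d n : ℕ} {Ω : Set (E n)} {V : Varifold d n Ω}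
    (hV : V.IsRectifiable) :
    ∃ (M : Set (E n)) (θ : E n → ℝ≥0) (T : E n → Grass d n), V.mass = weighted d M θ ∧
      ∀ᵐ x ∂V.mass, 0 < θ x ∧ IsApproxTangent M θ x (T x) := by
  obtain ⟨M, θ, T, -, -, -, -, hpos, hT, htan, hVm⟩ := hV
  have h1 : V.mass = weighted d M θ := by
    rw [Varifold.mass, hVm, Measure.map_map measurable_fst (measurable_id'.prodMk hT)]
    exact Measure.map_id
  refine ⟨M, θ, T, h1, ?_⟩
  rw [h1]
  have hac : weighted d M θ ≪ (hausdorff d n).restrict M := withDensity_absolutelyContinuous _ _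
  filter_upwards [hac.ae_le hpos, hac.ae_le htan] with x h2 h3 using ⟨h2, h3⟩

theorem Varifold.ae_mem_of_isOpen {d n : ℕ} {Ω : Set (E n)} (V : Varifold d n Ω)
    (hΩ : IsOpen Ω) : ∀ᵐ x ∂V.mass, x ∈ Ω := by
  rw [ae_iff]
  change V.mass Ωᶜ = 0
  rw [V.mass_apply hΩ.measurableSet.compl, V.measure_compl]

theorem exists_forall_isDominated {d n : ℕ} (hd : 1 ≤ d) {f : ℝ → ℝ} (hf : IsEta f) :
    ∃ Λ : ℝ, 0 < Λ ∧ ∀ Ω : Set (E n), IsOpen Ω → ∀ V : Varifold d n Ω, V.IsRectifiable →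
      ∀ᵐ x ∂V.mass, ∀ᶠ ε in 𝓝[>] (0 : ℝ), IsDominated V f x ε Λ := by
  obtain ⟨Λ, hΛ, H⟩ := exists_forall_isApproxTangent_eventually n hd hf
  refine ⟨Λ, hΛ, fun Ω hΩ V hV => ?_⟩
  obtain ⟨M, θ, T, hm, hae⟩ := hV.exists_weighted
  filter_upwards [hae, V.ae_mem_of_isOpen hΩ] with x hx hxΩ
  obtain ⟨r, hr, hrΩ⟩ := Metric.nhds_basis_closedBall.mem_iff.1 (hΩ.mem_nhds hxΩ)
  have h1 := H M θ x (T x) hx.1 hx.2 ⟨r, hr, by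
    rw [← hm]
    exact V.mass_closedBall_lt_top hrΩ⟩
  filter_upwards [h1, self_mem_nhdsWithin] with ε hε hε0
  rw [mem_Ioi] at hε0
  have h2 : V.massConv f ε x = (ε ^ n)⁻¹ * ∫ y, f (‖y - x‖ / ε) ∂(weighted d M θ) := by
    rw [← hm, ← integral_const_mul]
    rfl
  refine ⟨?_, ?_⟩
  · rw [h2]
    have := hε.1
    positivity
  · rw [h2, mul_inv_cancel_left₀ (by positivity), hm]
    exact hε.2

theorem IsXi.isEta {n : ℕ} {ξ : ℝ → ℝ} (hξ : IsXi n ξ) : IsEta ξ :=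
  ⟨hξ.toIsProfile, 1 / 2, by norm_num, (hξ.pos _ (by norm_num) (by norm_num)).ne'⟩

/-- For a point of the support, every late enough scale is good as soon as `z` is within distance
`ε`: the enlargement `s` of the ball, being small compared with `ε`, stays within the ball of
radius `3ε`. -/
theorem eventually_isGoodScale {d n : ℕ} {Ω : Set (E n)} (hΩ : IsOpen Ω) {V : Varifold d n Ω}
    {W : ℕ → Varifold d n Ω} {s δ : ℕ → ℝ} (hδ : ∀ h, 0 < δ h) {x : E n} (hx : x ∈ Ω)
    (hflat : ∃ r₀ : ℝ, 0 < r₀ ∧ ∀ r : ℝ, 0 < r → r < r₀ → Metric.ball x r ⊆ Ω → ∀ h,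
      flatDist (Metric.ball x r) V (W h) ≤
        ENNReal.ofReal (δ h) * min (V.mass (Metric.thickening (s h) (Metric.ball x r)))
          ((W h).mass (Metric.thickening (s h) (Metric.ball x r))))
    {ε : ℕ → ℝ} (hε : ∀ h, 0 < ε h) (hε0 : Tendsto ε atTop (𝓝 0))
    (hsε : Tendsto (fun h => s h / ε h) atTop (𝓝 0)) :
    ∀ᶠ h in atTop, ε h ≤ 1 ∧ Metric.closedBall x (3 * ε h) ⊆ Ω ∧
      ∀ z, dist x z ≤ ε h → IsGoodScale V (W h) x z (ε h) (δ h) := by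
  obtain ⟨r₀, hr₀, hflat⟩ := hflat
  obtain ⟨r, hr, hrΩ⟩ := Metric.nhds_basis_closedBall.mem_iff.1 (hΩ.mem_nhds hx)
  filter_upwards [hε0.eventually (gt_mem_nhds one_pos),
    hε0.eventually (gt_mem_nhds (div_pos hr three_pos)),
    hε0.eventually (gt_mem_nhds (div_pos hr₀ three_pos)),
    hsε.eventually (gt_mem_nhds one_half_pos)] with h h1 h2 h3 h4
  have hεh := hε h
  rw [div_lt_iff₀ hεh] at h4
  have hsub : Metric.closedBall x (3 * ε h) ⊆ Ω :=
    (Metric.closedBall_subset_closedBall (by linarith)).trans hrΩ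
  refine ⟨h1.le, hsub, fun z hz => ⟨hεh, h1.le, (hδ h).le, hz, hsub, ?_⟩⟩
  refine (hflat (5 / 2 * ε h) (by positivity) (by linarith)
    ((Metric.ball_subset_closedBall.trans (Metric.closedBall_subset_closedBall
      (by linarith))).trans hsub) h).trans ?_
  gcongr
  refine (min_le_left _ _).trans (measure_mono fun y hy => ?_)
  obtain ⟨w, hw, hyw⟩ := Metric.mem_thickening_iff.1 hy
  rw [Metric.mem_ball] at hw ⊢
  linarith [dist_triangle y w x]

theorem eventually_closedBall_subset {n : ℕ} {Ω : Set (E n)} (hΩ : IsOpen Ω) {x : E n}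
    (hx : x ∈ Ω) {z : ℕ → E n} (hz : Tendsto z atTop (𝓝 x)) {ε : ℕ → ℝ}
    (hε0 : Tendsto ε atTop (𝓝 0)) : ∀ᶠ h in atTop, Metric.closedBall (z h) (ε h) ⊆ Ω := by
  obtain ⟨r, hr, hrΩ⟩ := Metric.nhds_basis_closedBall.mem_iff.1 (hΩ.mem_nhds hx)
  filter_upwards [hε0.eventually (gt_mem_nhds (half_pos hr)),
    hz.eventually (Metric.ball_mem_nhds x (half_pos hr))] with h h1 h2
  exact (Metric.closedBall_subset_closedBall' (by linarith)).trans hrΩ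

theorem ofReal_le_ofReal_mul_mul_ofReal {a b C τ : ℝ} {N : ℝ≥0∞} (hC : 0 ≤ C) (hb : 0 ≤ b)
    (hN : ENNReal.ofReal b ≤ N) (h : a ≤ C * b * τ) :
    ENNReal.ofReal a ≤ ENNReal.ofReal C * N * ENNReal.ofReal τ := by
  refine (ENNReal.ofReal_le_ofReal h).trans ?_
  rw [ENNReal.ofReal_mul (by positivity), ENNReal.ofReal_mul hC]
  gcongr

end WSFF

/-! ### The convergence theorem -/

open WSFF

theorem mainTheorem1 (n d : ℕ) (hd : 1 ≤ d) (hdn : d ≤ n)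
    (ξ η : ℝ → ℝ) (hξ : WSFF.IsXi n ξ) (hη : WSFF.IsEta η) :
    ∃ C : ℝ, 0 < C ∧ ∃ κ : ℝ, 0 < κ ∧
    ∀ ρ : ℝ → ℝ, WSFF.IsRho n ρ →
    ∀ Ω : Set (WSFF.E n), IsOpen Ω →
    ∀ V : WSFF.Varifold d n Ω, V.IsRectifiable → V.HasBoundedVariations →
    ∀ (W : ℕ → WSFF.Varifold d n Ω) (s δ : ℕ → ℝ),
      (∀ h, 0 < s h) → Antitone s → Tendsto s atTop (𝓝 0) →
      (∀ h, 0 < δ h) → Antitone δ → Tendsto δ atTop (𝓝 0) →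
      (∀ a ∈ V.mass.support, ∃ r₀ : ℝ, 0 < r₀ ∧ ∀ r : ℝ, 0 < r → r < r₀ →
        Metric.ball a r ⊆ Ω → ∀ h,
          WSFF.flatDist (Metric.ball a r) V (W h) ≤
            ENNReal.ofReal (δ h) * min (V.mass (Metric.thickening (s h) (Metric.ball a r)))
              ((W h).mass (Metric.thickening (s h) (Metric.ball a r)))) →
    ∀ᵐ x ∂V.mass, ∀ z : ℕ → WSFF.E n, Tendsto z atTop (𝓝 x) →
    ∀ ε : ℕ → ℝ, (∀ h, 0 < ε h) → Tendsto ε atTop (𝓝 0) →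
      Tendsto (fun h => s h / ε h) atTop (𝓝 0) →
      (∀ᶠ h in atTop,
        0 < V.massConv ξ (ε h) x ∧ 0 < V.massConv η (ε h) x ∧
        (∀ j k, ENNReal.ofReal |(W h).cApprox η (ε h) (z h) j k - V.cApprox η (ε h) x j k| ≤
          ENNReal.ofReal C * WSFF.normW1 ρ * ENNReal.ofReal ((δ h + dist x (z h)) / ε h)) ∧
        (δ h + dist x (z h) ≤ κ * ε h →
          0 < (W h).massConv ξ (ε h) (z h) ∧ 0 < (W h).massConv η (ε h) (z h) ∧
          ∀ i j k,
            ENNReal.ofReal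
                |(W h).betaApprox ρ ξ (ε h) (z h) i j k - V.betaApprox ρ ξ (ε h) x i j k| ≤
              ENNReal.ofReal C * WSFF.normW2 ρ *
                ENNReal.ofReal ((δ h + dist x (z h)) / ε h ^ 2) ∧
            ENNReal.ofReal
                |(W h).aApprox ρ ξ η (ε h) (z h) i j k - V.aApprox ρ ξ η (ε h) x i j k| ≤
              ENNReal.ofReal C * WSFF.normW2 ρ *
                ENNReal.ofReal ((δ h + dist x (z h)) / ε h ^ 2))) ∧
      (Tendsto (fun h => (δ h + dist x (z h)) / ε h ^ 2) atTop (𝓝 0) →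
        (WSFF.normW2 ρ ≠ ∞ →
          Tendsto (fun h => ENNReal.ofReal C * WSFF.normW2 ρ *
            ENNReal.ofReal ((δ h + dist x (z h)) / ε h ^ 2)) atTop (𝓝 0)) ∧
        Tendsto (fun h => ENNReal.ofReal C * WSFF.normW1 ρ *
          ENNReal.ofReal ((δ h + dist x (z h)) / ε h)) atTop (𝓝 0)) := by
  obtain ⟨K, hK, hbξ, hlξ⟩ := hξ.exists_bound
  obtain ⟨K', hK', hbη, hlη⟩ := hη.exists_bound
  obtain ⟨Λ, hΛ, Hξ⟩ := exists_forall_isDominated (n := n) hd hξ.isEta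
  obtain ⟨Λ', hΛ', Hη⟩ := exists_forall_isDominated (n := n) hd hη
  have hd0 : (0 : ℝ) < d := by exact_mod_cast hd
  have hn0 : (0 : ℝ) < n := by exact_mod_cast hd.trans hdn
  have hωd := omega_pos d
  have hωn := omega_pos n
  set v := volume.real (Metric.closedBall (0 : E n) 1) with hv
  have hv0 : 0 < v := ENNReal.toReal_pos (Metric.measure_closedBall_pos volume _ one_pos).ne'
    measure_closedBall_lt_top.ne
  -- `Γ` bounds `C_ξ / C_ρ` for all `ρ`; `κ` keeps the denominators of `W` above half those of `V`
  set Γ := |kernelConst d ξ| / (d * omega d / (n * omega n)) with hΓ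
  have hΓ0 : 0 ≤ Γ := by positivity
  set κ := min 1 (min (1 / (2 * (K * Λ))) (1 / (2 * (K' * Λ')))) with hκ
  have hκ0 : 0 < κ := by positivity
  set c₁ := 6 * K' * Λ' with hc₁
  set b₁ := 2 * Γ * Λ * (12 + K * Λ) with hb₁
  set a₁ := (1 + (n : ℝ) ^ 2) * b₁ + ((n : ℝ) ^ 4 + (n : ℝ) ^ 2) * (c₁ * (Γ * Λ)) with ha₁
  have hc₁0 : 0 < c₁ := by positivity
  have hb₁0 : 0 ≤ b₁ := by positivity
  have ha₁0 : 0 ≤ a₁ := by positivity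
  set C := b₁ + a₁ + c₁ * v + 2 * v / κ with hC
  have hq0 : 0 < 2 * v / κ := by positivity
  have hcv0 : 0 < c₁ * v := by positivity
  have hC0 : 0 < C := by positivity
  refine ⟨C, hC0, κ, hκ0, fun ρ hρ Ω hΩ V hV _ W s δ _ _ _ hδ _ _ hflat => ?_⟩
  have hΓρ : |kernelConst d ξ / kernelConst d ρ| ≤ Γ := by
    have h1 := hρ.le_kernelConst hd hdn
    have h2 : 0 < d * omega d / (n * omega n) := by positivity
    rw [abs_div, abs_of_pos (h2.trans_le h1)]
    exact div_le_div_of_nonneg_left (abs_nonneg _) h2 h1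
  filter_upwards [Hξ Ω hΩ V hV, Hη Ω hΩ V hV, V.ae_mem_of_isOpen hΩ, Measure.support_mem_ae]
    with x hxξ hxη hxΩ hxs z hz ε hε hε0 hsε
  have hε0' : Tendsto ε atTop (𝓝[>] 0) :=
    tendsto_nhdsWithin_iff.2 ⟨hε0, Eventually.of_forall hε⟩
  refine ⟨?_, fun hlim => ⟨fun hW2 => ?_, ?_⟩⟩
  · filter_upwards [hε0'.eventually hxξ, hε0'.eventually hxη,
      eventually_isGoodScale hΩ hδ hxΩ (hflat x hxs) hε hε0 hsε,
      eventually_closedBall_subset hΩ hxΩ hz hε0] with h hDξ hDη hgood hzΩ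
    obtain ⟨hε1, hxΩ3, hgood⟩ := hgood
    have hεh := hε h
    have hδh := hδ h
    set τ := (δ h + dist x (z h)) / ε h with hτ
    have hτ0 : 0 < τ := div_pos (add_pos_of_pos_of_nonneg hδh dist_nonneg) hεh
    have hxΩ1 : Metric.closedBall x (ε h) ⊆ Ω :=
      (Metric.closedBall_subset_closedBall (by linarith)).trans hxΩ3
    have hscale : τ ≤ κ → IsGoodScale V (W h) x (z h) (ε h) (δ h) := fun hle => by
      refine hgood _ ?_
      have h1 := (div_le_iff₀ hεh).1 (hle.trans (min_le_left _ _))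
      linarith
    have hsξ : τ ≤ κ → K * Λ * τ ≤ 1 / 2 := fun hle => by
      have h1 := (le_div_iff₀ (by positivity)).1
        (hle.trans ((min_le_right _ _).trans (min_le_left _ _)))
      linarith
    have hsη : τ ≤ κ → K' * Λ' * τ ≤ 1 / 2 := fun hle => by
      have h1 := (le_div_iff₀ (by positivity)).1
        (hle.trans ((min_le_right _ _).trans (min_le_right _ _)))
      linarith
    have hcsub : τ ≤ κ → ∀ j k,
        |(W h).cApprox η (ε h) (z h) j k - V.cApprox η (ε h) x j k| ≤ c₁ * τ := fun hle =>
      (hscale hle).abs_cApprox_sub_le hη.toIsProfile hDη hK'.le hbη hlη (hsη hle)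
    refine ⟨hDξ.pos, hDη.pos, fun j k => ?_, fun hle => ?_⟩
    · refine ofReal_le_ofReal_mul_mul_ofReal hC0.le (by positivity) hρ.ofReal_inv_le_normW1 ?_
      rcases le_or_gt τ κ with hle | hlt
      · refine (hcsub hle j k).trans ?_
        have h1 : c₁ = c₁ * v * v⁻¹ := by field_simp
        calc c₁ * τ = c₁ * v * v⁻¹ * τ := by rw [← h1]
          _ ≤ C * v⁻¹ * τ := by
            gcongr
            linarith
      · -- the entries of both matrices are bounded by `1`, so the estimate is trivial
        refine (abs_sub _ _).trans ((add_le_add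
          ((W h).abs_cApprox_le_one hη.toIsProfile hεh hε1 hzΩ j k)
          (V.abs_cApprox_le_one hη.toIsProfile hεh hε1 hxΩ1 j k)).trans ?_)
        calc (1 : ℝ) + 1 = 2 * v / κ * v⁻¹ * κ := by field_simp; norm_num
          _ ≤ C * v⁻¹ * τ := by
            gcongr
            linarith
    · have hle' : τ ≤ κ := (div_le_iff₀ hεh).2 hle
      have hg := hscale hle'
      have hpos : ∀ {D D' b : ℝ}, 0 < D → |D' - D| ≤ b * D → b ≤ 1 / 2 → 0 < D' :=
        fun hD h1 h2 => (half_pos hD).trans_le (half_le_of_abs_sub_le hD h1 h2)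
      refine ⟨hpos hDξ.pos (hg.abs_massConv_sub_le hξ.toIsProfile hDξ hK.le hbξ hlξ) (hsξ hle'),
        hpos hDη.pos (hg.abs_massConv_sub_le hη.toIsProfile hDη hK'.le hbη hlη) (hsη hle'),
        fun i j k => ?_⟩
      have hσ0 : 0 < (δ h + dist x (z h)) / ε h ^ 2 :=
        div_pos (add_pos_of_pos_of_nonneg hδh dist_nonneg) (by positivity)
      by_cases hW2 : normW2 ρ = ∞
      · rw [hW2, ENNReal.mul_top (ENNReal.ofReal_pos.2 hC0).ne',
          ENNReal.top_mul (ENNReal.ofReal_pos.2 hσ0).ne']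
        exact ⟨le_top, le_top⟩
      set R := (normW2 ρ).toReal with hR
      have hR0 : 0 ≤ R := ENNReal.toReal_nonneg
      have hbρ : ∀ t, 0 ≤ t → |derivWithin ρ (Ici 0) t| ≤ R := fun t ht =>
        abs_derivWithin_le_toReal_normW2 hW2 ht
      have hlρ : ∀ s t, 0 ≤ s → 0 ≤ t →
          |derivWithin ρ (Ici 0) s - derivWithin ρ (Ici 0) t| ≤ R * |s - t| := fun s t hs ht =>
        abs_derivWithin_sub_le_toReal_normW2 hW2 hs ht
      have hβ := hg.abs_betaApprox_sub_le hξ.toIsProfile hDξ hK.le hbξ hlξ (hsξ hle') hρ hR0 hbρ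
        hlρ hΓρ
      have hβV := fun i j k => (hg.abs_betaApprox_le hDξ hρ hR0 hbρ hlρ hΓρ i j k).2
      have hA := abs_solveSystem_sub_le
        (V.dotProduct_cApprox_nonneg hη.toIsProfile hεh hε1 hxΩ1)
        ((W h).dotProduct_cApprox_nonneg hη.toIsProfile hεh hε1 hzΩ)
        ((W h).abs_cApprox_le_one hη.toIsProfile hεh hε1 hzΩ) (hcsub hle') hβ hβV i j k
      have hRW : ENNReal.ofReal R ≤ normW2 ρ := ENNReal.ofReal_toReal_le
      refine ⟨ofReal_le_ofReal_mul_mul_ofReal hC0.le hR0 hRW ((hβ i j k).trans ?_),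
        ofReal_le_ofReal_mul_mul_ofReal hC0.le hR0 hRW (hA.trans ?_)⟩
      · gcongr
        linarith
      · calc (1 + (n : ℝ) ^ 2) * (b₁ * R * ((δ h + dist x (z h)) / ε h ^ 2))
              + ((n : ℝ) ^ 4 + (n : ℝ) ^ 2) * (c₁ * τ * (Γ * Λ * R / ε h))
            = a₁ * R * ((δ h + dist x (z h)) / ε h ^ 2) := by
              rw [ha₁, hτ]
              field_simp
          _ ≤ C * R * ((δ h + dist x (z h)) / ε h ^ 2) := by
              gcongr
              linarith
  · have h1 := ENNReal.Tendsto.const_mul (a := ENNReal.ofReal C * normW2 ρ)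
      (ENNReal.tendsto_ofReal hlim) (Or.inr (ENNReal.mul_ne_top ENNReal.ofReal_ne_top hW2))
    simpa using h1
  · have h0 : Tendsto (fun h => (δ h + dist x (z h)) / ε h) atTop (𝓝 0) := by
      have h1 := hlim.mul hε0
      rw [zero_mul] at h1
      refine h1.congr fun h => ?_
      have := hε h
      field_simp
    have h1 := ENNReal.Tendsto.const_mul (a := ENNReal.ofReal C * normW1 ρ)
      (ENNReal.tendsto_ofReal h0)
      (Or.inr (ENNReal.mul_ne_top ENNReal.ofReal_ne_top hρ.normW1_ne_top))
    simpa using h1
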